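/- Let $\mathfrak g=\bigoplus_{n\in\mathbb Z}\mathfrak g_n$ be a $\mathbb Z$-graded Lie algebra over a field $\Bbbk$ of characteristic zero, with all $\mathfrak g_n$ finite-dimensional. Let $\mathfrak M$ be a $\Bbbk$-basis of $\mathfrak g$ consisting of homogeneous elements, with a total order $<$ such that $\deg M<\deg N$ implies $M<N$. For $0\neq e\in\mathfrak g$ let $\ell_+(e)$ (resp. $\ell_-(e)$) be the largest (resp. smallest) element of $\mathfrak M$ occurring in $e$. For $M\in\mathfrak M$ let $\mathcal L_+(M)$ be the set of all $K\in\mathfrak M$ for which there is a nonempty finite tuple $(M_1,\dots,M_n)$ of elements of $\mathfrak M$ of positive degree such that $K=\ell_+([[M,M_1],\dots,M_n])$ and $\ell_+([[N,M_1],\dots,M_n])<K$ for every $N\in\mathfrak M$ with $N<M$ and $[[N,M_1],\dots,M_n]\ne0$. Define $\mathcal L_-(M)$ in the same way with elements of negative degree, $\ell_-$, and all inequalities reversed. Assume that $\mathfrak g$ is Dicksonian with respect to $(\mathfrak M,<)$: there is no infinite sequence of distinct pairs $(M_i,N_i)_{i\ge1}$ in $\mathfrak M\times\mathfrak M$ with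 $M_i\le N_i$ for all $i$, and $M_j\notin\mathcal L_-(M_i)$ and $N_j\notin\mathcal L_+(N_i)$ for all $i<j$. The symmetric algebra $S(\mathfrak g)=\Bbbk[\mathfrak M]$ carries the Poisson bracket $\{-,-\}$ extending the Lie bracket of $\mathfrak g$. For nonconstant $f\in\Bbbk[\mathfrak M]$ let $\ell_+(f)$ and $\ell_-(f)$ be the largest and smallest elements of $\mathfrak M$ appearing in $f$, let $d_{+,f}$ be the degree of $f$ in $\ell_+(f)$, let $i_{+,f}$ be the coefficient of $\ell_+(f)^{d_{+,f}}$ in $f$ viewed as a polynomial in $\ell_+(f)$, and let $s_f=\frac{\partial f}{\partial \ell_+(f)}\cdot\frac{\partial f}{\partial \ell_-(f)}$. Call $g$ reduced with respect to $f$ if no element of $\mathcal L_+(\ell_+(f))\cup\mathcal L_-(\ell_-(f))$ appears in $g$ and the degree of $g$ in $\ell_+(f)$ is less than $d_{+,f}$. A finite sequence $\Lambda=(f_1,\dots,f_r)$ of nonconstant elements is reduced if $f_j$ is reduced with respect to $f_i$ for all $i<j$. Put $i_+s_\Lambda=\prod_{f\in\Lambda}i_{+,f}\,s_f$, and let $[\Lambda]$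 be the Poisson ideal of $S(\mathfrak g)$ generated by $\Lambda$. **Theorem.** If $P$ is a nonzero prime Poisson ideal of $S(\mathfrak g)$, then there is a finite reduced sequence $\Lambda$ of elements of $P$ such that $i_+s_\Lambda\notin P$ and $$P=[\Lambda]:(i_+s_\Lambda)^\infty=\{f\in S(\mathfrak g): f\,(i_+s_\Lambda)^n\in[\Lambda]\text{ for some }n\ge0\}.$$ -/

import Mathlib

open MvPolynomial

namespace DicksonLie

universe u v w

/-- A basis of a `ℤ`-graded Lie algebra made of homogeneous elements, with a total order compatible
with the grading. The basis elements are indexed by `ι`, and the order is the one on `ι`. -/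
structure HomogeneousBasis {k : Type u} {L : Type v} [Field k] [LieRing L] [LieAlgebra k L]
    (𝒢 : ℤ → Submodule k L) (ι : Type w) [LinearOrder ι] where
  /-- The basis. -/
  basis : Module.Basis ι k L
  /-- The degrees of the basis elements. -/
  deg : ι → ℤ
  basis_mem : ∀ i, basis i ∈ 𝒢 (deg i)
  lt_of_deg_lt : ∀ i j, deg i < deg j → i < j

noncomputable section

/-! ### Leaders in the Lie algebra and leading-Dicksonian sequences -/

namespace HomogeneousBasis

variable {k : Type u} {L : Type v} {ι : Type w} [Field k] [LieRing L] [LieAlgebra k L]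
  [LinearOrder ι] {𝒢 : ℤ → Submodule k L} (B : HomogeneousBasis 𝒢 ι)

/-- The largest basis element occurring in `e`; it is `⊥` exactly when `e = 0`. -/
def upperLeader (e : L) : WithBot ι := (B.basis.repr e).support.max

/-- The smallest basis element occurring in `e`; it is `⊤` exactly when `e = 0`. -/
def lowerLeader (e : L) : WithTop ι := (B.basis.repr e).support.min

/-- The iterated bracket `[[[e, M₁], M₂], …, Mₙ]` for the tuple `(M₁, …, Mₙ)` of basis elements. -/
def iterBracket (t : List ι) (e : L) : L := t.foldl (fun x M => ⁅x, B.basis M⁆) e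

/-- The set `𝓛₊(M)`: all basis elements `K = ℓ₊([[M, M₁], …, Mₙ])`, for nonempty tuples
`(M₁, …, Mₙ)` of basis elements of positive degree, such that `ℓ₊([[N, M₁], …, Mₙ]) < K` for all
basis elements `N < M` with `[[N, M₁], …, Mₙ] ≠ 0`. -/
def upperSet (M : ι) : Set ι :=
  {K | ∃ t : List ι, t ≠ [] ∧ (∀ j ∈ t, 0 < B.deg j) ∧
    B.upperLeader (B.iterBracket t (B.basis M)) = (K : WithBot ι) ∧
    ∀ N < M, B.iterBracket t (B.basis N) ≠ 0 →
      B.upperLeader (B.iterBracket t (B.basis N)) < (K : WithBot ι)}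

/-- The set `𝓛₋(M)`: all basis elements `K = ℓ₋([[M, M₁], …, Mₙ])`, for nonempty tuples
`(M₁, …, Mₙ)` of basis elements of negative degree, such that `K < ℓ₋([[N, M₁], …, Mₙ])` for all
basis elements `N > M` with `[[N, M₁], …, Mₙ] ≠ 0`. -/
def lowerSet (M : ι) : Set ι :=
  {K | ∃ t : List ι, t ≠ [] ∧ (∀ j ∈ t, B.deg j < 0) ∧
    B.lowerLeader (B.iterBracket t (B.basis M)) = (K : WithTop ι) ∧
    ∀ N > M, B.iterBracket t (B.basis N) ≠ 0 →
      (K : WithTop ι) < B.lowerLeader (B.iterBracket t (B.basis N))}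

/-- An infinite leading-Dicksonian sequence of distinct pairs `(Mₙ, Nₙ)`. -/
structure IsLeadingDicksonianSeq (s : ℕ → ι × ι) : Prop where
  injective : Function.Injective s
  le : ∀ n, (s n).1 ≤ (s n).2
  lower : ∀ i j, i < j → (s j).1 ∉ B.lowerSet (s i).1
  upper : ∀ i j, i < j → (s j).2 ∉ B.upperSet (s i).2

/-- The ordered basis has no infinite leading-Dicksonian sequence. A graded Lie algebra is
Dicksonian when it has such an ordered homogeneous basis. -/
def IsDicksonian : Prop := ¬ ∃ s : ℕ → ι × ι, B.IsLeadingDicksonianSeq s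

/-! ### The Poisson algebra `S(𝔤)`

`S(𝔤)` is the polynomial ring over `k` in the basis elements: by
`SymmetricAlgebra.equivMvPolynomial` it is the symmetric algebra of `𝔤`, with `𝔤` embedded by the
`k`-linear map that sends a basis element to the corresponding variable. -/

/-- The embedding of the Lie algebra in `S(𝔤)`. -/
def toSym : L →ₗ[k] MvPolynomial ι k := B.basis.constr k (X : ι → MvPolynomial ι k)

/-- The Poisson bracket of `S(𝔤)`: the biderivation which extends the Lie bracket. -/
def poisson (f g : MvPolynomial ι k) : MvPolynomial ι k :=
  mkDerivation k
    (fun i => mkDerivation k (fun j => B.toSym ⁅B.basis i, B.basis j⁆) g) f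

/-- An ideal is Poisson if it is stable under bracketing with arbitrary elements. -/
def IsPoissonIdeal (I : Ideal (MvPolynomial ι k)) : Prop :=
  ∀ f ∈ I, ∀ g, B.poisson f g ∈ I

/-- The Poisson ideal generated by a set: the smallest Poisson ideal containing it. -/
def poissonSpan (S : Set (MvPolynomial ι k)) : Ideal (MvPolynomial ι k) :=
  sInf {I | B.IsPoissonIdeal I ∧ S ⊆ I}

end HomogeneousBasis

/-! ### Leaders, initials and separants in `S(𝔤)` -/

section Polynomial

variable {k : Type u} {ι : Type w} [Field k] [LinearOrder ι]

/-- The coefficient of `M ^ n` when `f` is written as a polynomial in the variable `M`, with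
coefficients free of `M`. -/
def coeffIn (f : MvPolynomial ι k) (M : ι) (n : ℕ) : MvPolynomial ι k :=
  ∑ m ∈ f.support with m M = n, monomial (m.erase M) (f.coeff m)

/-- The largest variable in a nonconstant polynomial. -/
def polyUpperLeader (f : MvPolynomial ι k) (hf : f.vars.Nonempty) : ι := f.vars.max' hf

/-- The smallest variable in a nonconstant polynomial. -/
def polyLowerLeader (f : MvPolynomial ι k) (hf : f.vars.Nonempty) : ι := f.vars.min' hf

open Classical in
/-- The upper initial `i₊` of a nonconstant polynomial: the coefficient of the highest power of
its upper leader. (The value at constants is immaterial.) -/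
def upperInitial (f : MvPolynomial ι k) : MvPolynomial ι k :=
  if hf : f.vars.Nonempty then
    coeffIn f (polyUpperLeader f hf) (f.degreeOf (polyUpperLeader f hf))
  else 0

open Classical in
/-- The upper separant `s₊` of a nonconstant polynomial: its partial derivative with respect to its
upper leader. -/
def upperSeparant (f : MvPolynomial ι k) : MvPolynomial ι k :=
  if hf : f.vars.Nonempty then pderiv (polyUpperLeader f hf) f else 0

open Classical in
/-- The lower separant `s₋` of a nonconstant polynomial: its partial derivative with respect to its
lower leader. -/
def lowerSeparant (f : MvPolynomial ι k) : MvPolynomial ι k :=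
  if hf : f.vars.Nonempty then pderiv (polyLowerLeader f hf) f else 0

/-- The separant `s = s₊ s₋`. -/
def separant (f : MvPolynomial ι k) : MvPolynomial ι k := upperSeparant f * lowerSeparant f

/-- The product `i₊s_Λ` of the upper initials and of the separants of the members of `Λ`. -/
def initSep (Λ : List (MvPolynomial ι k)) : MvPolynomial ι k :=
  (Λ.map fun f => upperInitial f * separant f).prod

/-- The division ideal `I : s^∞`. -/
def divInfinity (I : Ideal (MvPolynomial ι k)) (s : MvPolynomial ι k) :
    Ideal (MvPolynomial ι k) where
  carrier := {f | ∃ n : ℕ, f * s ^ n ∈ I}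
  zero_mem' := ⟨0, by simp⟩
  add_mem' := by
    rintro f g ⟨m, hm⟩ ⟨n, hn⟩
    refine ⟨m + n, ?_⟩
    have h : (f + g) * s ^ (m + n) = s ^ n * (f * s ^ m) + s ^ m * (g * s ^ n) := by ring
    rw [h]
    exact I.add_mem (I.mul_mem_left _ hm) (I.mul_mem_left _ hn)
  smul_mem' := by
    rintro c f ⟨n, hn⟩
    refine ⟨n, ?_⟩
    rw [smul_eq_mul, mul_assoc]
    exact I.mul_mem_left _ hn

end Polynomial

/-! ### Reduced sequences -/

namespace HomogeneousBasis

variable {k : Type u} {L : Type v} {ι : Type w} [Field k] [LieRing L] [LieAlgebra k L]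
  [LinearOrder ι] {𝒢 : ℤ → Submodule k L} (B : HomogeneousBasis 𝒢 ι)

/-- `g` is partially reduced with respect to the nonconstant polynomial `f`: no element of
`𝓛₊(ℓ₊(f))` and no element of `𝓛₋(ℓ₋(f))` appears in `g`. -/
def IsPartiallyReduced (f : MvPolynomial ι k) (hf : f.vars.Nonempty)
    (g : MvPolynomial ι k) : Prop :=
  (∀ M ∈ g.vars, M ∉ B.upperSet (polyUpperLeader f hf)) ∧
    ∀ M ∈ g.vars, M ∉ B.lowerSet (polyLowerLeader f hf)

/-- `g` is reduced with respect to the nonconstant polynomial `f`: it is partially reduced, and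
its degree in the upper leader of `f` is smaller than the one of `f`. -/
def IsReduced (f : MvPolynomial ι k) (hf : f.vars.Nonempty) (g : MvPolynomial ι k) : Prop :=
  B.IsPartiallyReduced f hf g ∧
    g.degreeOf (polyUpperLeader f hf) < f.degreeOf (polyUpperLeader f hf)

/-- A finite reduced sequence: all members are nonconstant, and each one is reduced with respect to
all the previous ones. (The members are then automatically distinct.) -/
def IsReducedSeq (Λ : List (MvPolynomial ι k)) : Prop :=
  (∀ f ∈ Λ, f.vars.Nonempty) ∧
    Λ.Pairwise fun f g => ∀ hf : f.vars.Nonempty, B.IsReduced f hf g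

end HomogeneousBasis

end

end DicksonLie

/-!
Proof that a prime Poisson ideal `P` of `S(𝔤)` is `[Λ] : (i₊s_Λ)^∞` for a finite reduced sequence
`Λ`.

*Nested lists are reduced.* All elements of `𝓛₊(M)` are larger than `M`, and all elements of
`𝓛₋(M)` are smaller. Hence a list is reduced as soon as the variables of each member lie between the
two leaders of every previous member `f`, and its degree in `ℓ₊(f)` is smaller than that of `f`
(`IsCompleteList.isReducedSeq`).

*Finitely many variables.* For a finite set `I` of variables there is a nested list in `P ∩ k[I]`,
with initials and separants outside `P`, such that every ideal which contains the list and is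
saturated with respect to `i₊s_Λ` contains `P ∩ k[I]` (`exists_isCompleteList`). It is a triangular
set, obtained by adding the variables in increasing order: each variable that is algebraic over the
previous ones modulo `P` gives a polynomial of least degree in that variable. Such a polynomial may
be changed by an element of `P` in the previous variables, and this is used to make the ranges of
variables nested. Putting one more multiple of the first polynomial in front makes saturated ideals
also saturated with respect to a prescribed `m ∉ P` (`exists_isCompleteList_saturated`).

*Reduction to finitely many variables.* Call `(a, b)` a leader pair if it consists of the smallest
and the largest variable of some `f ∈ P` whose derivatives, in all variables of `f`, are outside
`P`. By the Dicksonian hypothesis, finitely many leader pairs `(aᵢ, bᵢ)`, coming from polynomials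
`fᵢ`, suffice for every leader pair `(a, b)` to be one of them, or to satisfy `a ∈ 𝓛₋(aᵢ)` or
`b ∈ 𝓛₊(bᵢ)` for some `i` (`HomogeneousBasis.IsDicksonian.exists_finset`). Let `I` be a finite
interval containing these pairs, let `m` be the product of the separants of the `fᵢ`, let `Λ` be the
list for `I` and `m`, and let `J = [Λ] : (i₊s_Λ)^∞`. Intervals containing `I` are built up by adding
a largest or a smallest variable `v`; say a largest one. If `P` has a polynomial which really
depends on `v`, take one whose smallest variable `a` is as large as possible. Then `(a, v)` is a
leader pair. If `K ∈ 𝓛₊(bᵢ)` or `K ∈ 𝓛₋(aᵢ)`, an iterated bracket of `fᵢ` is a relation `s K + T` of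
degree one in `K`, where `s` is a separant of `fᵢ` and `T` only has variables between `K` and the
opposite leader of `fᵢ` (`exists_leading_form`). So `a ∈ 𝓛₋(aᵢ)` is impossible, because `a` could be
eliminated in favour of larger variables; thus `v ∈ 𝓛₊(bᵢ)`, and `v` is eliminated using a relation
in `J` (`le_of_forall_interval`). Therefore `P ⊆ J`; the reverse inclusion holds because `P` is
prime and Poisson and `i₊s_Λ ∉ P`.
-/

namespace DicksonLie

/-! ### Derivatives, degrees and supports of polynomials -/

section Calculus

variable {k : Type*} {ι : Type*} [Field k]

lemma derivation_mem_supported (D : Derivation k (MvPolynomial ι k) (MvPolynomial ι k))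
    {S T : Set ι} (hST : S ⊆ T) (hD : ∀ i ∈ S, D (X i) ∈ supported k T)
    {f : MvPolynomial ι k} (hf : f ∈ supported k S) : D f ∈ supported k T := by
  rw [supported_eq_adjoin_X] at hf
  induction hf using Algebra.adjoin_induction with
  | mem x hx =>
    obtain ⟨i, hi, rfl⟩ := hx
    exact hD i hi
  | algebraMap r => simp
  | add x y _ _ hx hy => rw [map_add]; exact add_mem hx hy
  | mul x y hx' hy' hx hy =>
    rw [← supported_eq_adjoin_X] at hx' hy'
    rw [D.leibniz, smul_eq_mul, smul_eq_mul]
    exact add_mem (mul_mem (supported_mono hST hx') hy) (mul_mem (supported_mono hST hy') hx)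

lemma pderiv_mem_supported {S : Set ι} {f : MvPolynomial ι k} (y : ι)
    (hf : f ∈ supported k S) : pderiv y f ∈ supported k S := by
  classical
  refine derivation_mem_supported _ subset_rfl (fun i _ => ?_) hf
  rw [pderiv_X]
  by_cases h : i = y
  · subst h; simp
  · simp [h]

lemma pderiv_eq_zero_of_mem_supported {S : Set ι} {f : MvPolynomial ι k} {y : ι}
    (hf : f ∈ supported k S) (hy : y ∉ S) : pderiv y f = 0 :=
  pderiv_eq_zero_of_notMem_vars fun h => hy (mem_supported.1 hf h)

lemma degreeOf_eq_zero_of_mem_supported {S : Set ι} {f : MvPolynomial ι k} {y : ι}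
    (hf : f ∈ supported k S) (hy : y ∉ S) : degreeOf y f = 0 := by
  by_contra h
  exact hy (mem_supported.1 hf (mem_vars_iff_degreeOf_ne_zero.2 h))

lemma mem_vars_of_pderiv_notMem {P : Ideal (MvPolynomial ι k)} {f : MvPolynomial ι k} {y : ι}
    (h : pderiv y f ∉ P) : y ∈ f.vars := by
  by_contra hy
  exact h (by rw [pderiv_eq_zero_of_notMem_vars hy]; exact P.zero_mem)

lemma mem_supported_of_support_subset {S : Set ι} {f g : MvPolynomial ι k}
    (h : g.support ⊆ f.support) (hf : f ∈ supported k S) : g ∈ supported k S := by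
  rw [mem_supported] at *
  intro y hy
  obtain ⟨m, hm, hym⟩ := (mem_vars_iff_mem_support y).1 hy
  exact hf ((mem_vars_iff_mem_support y).2 ⟨m, h hm, hym⟩)

lemma coeff_X_mul_pderiv (f : MvPolynomial ι k) (y : ι) (m : ι →₀ ℕ) :
    coeff m (X y * pderiv y f) = m y * coeff m f := by
  induction f using MvPolynomial.induction_on' with
  | add p q hp hq => simp [mul_add, hp, hq]
  | monomial n a =>
    classical
    rw [X_mul_pderiv_monomial, coeff_smul, coeff_monomial]
    split_ifs with h
    · subst h; simp
    · simp

/-- The Euler combination `d f - y ∂f/∂y` multiplies the coefficient of a monomial of degree `e`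
in `y` by `d - e`. In particular it removes the terms of degree `d` in `y`. -/
lemma coeff_euler (f : MvPolynomial ι k) (y : ι) (d : ℕ) (m : ι →₀ ℕ) :
    coeff m (C (d : k) * f - X y * pderiv y f) = ((d : k) - m y) * coeff m f := by
  rw [coeff_sub, coeff_C_mul, coeff_X_mul_pderiv, sub_mul]

lemma support_euler_subset (f : MvPolynomial ι k) (y : ι) (d : ℕ) :
    (C (d : k) * f - X y * pderiv y f).support ⊆ f.support := by
  intro m hm
  rw [mem_support_iff, coeff_euler] at hm
  exact mem_support_iff.2 (right_ne_zero_of_mul hm)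

lemma degreeOf_le_of_support_subset {f g : MvPolynomial ι k} (h : g.support ⊆ f.support) (x : ι) :
    degreeOf x g ≤ degreeOf x f :=
  degreeOf_le_iff.2 fun _ hm => monomial_le_degreeOf x (h hm)

lemma degreeOf_euler_lt {f : MvPolynomial ι k} {x : ι} (h : 0 < degreeOf x f) :
    degreeOf x (C (degreeOf x f : k) * f - X x * pderiv x f) < degreeOf x f := by
  rw [degreeOf_lt_iff h]
  intro m hm
  refine lt_of_le_of_ne (monomial_le_degreeOf x (support_euler_subset f x _ hm)) fun he => ?_
  rw [mem_support_iff, coeff_euler, he] at hm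
  simp at hm

lemma degreeOf_pderiv_le (f : MvPolynomial ι k) (x y : ι) :
    degreeOf x (pderiv y f) ≤ degreeOf x f := by
  refine degreeOf_le_iff.2 fun m hm => ?_
  rw [mem_support_iff, coeff_pderiv] at hm
  refine le_trans ?_ (monomial_le_degreeOf x (mem_support_iff.2 (left_ne_zero_of_mul hm)))
  simp

lemma degreeOf_pderiv_self_lt {f : MvPolynomial ι k} {x : ι} (h : 0 < degreeOf x f) :
    degreeOf x (pderiv x f) < degreeOf x f := by
  rw [degreeOf_lt_iff h]
  intro m hm
  rw [mem_support_iff, coeff_pderiv] at hm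
  have := monomial_le_degreeOf x (mem_support_iff.2 (left_ne_zero_of_mul hm))
  simp at this
  omega

/-- A measure of the size of a polynomial: the sum of `1 + |m|` over its monomials `m`. It
decreases when terms are dropped, and when a derivative is taken. -/
noncomputable def weight (f : MvPolynomial ι k) : ℕ := ∑ m ∈ f.support, (1 + m.degree)

lemma weight_lt_of_support_ssubset {f g : MvPolynomial ι k} (h : g.support ⊂ f.support) :
    weight g < weight f := by
  obtain ⟨m, hm, hm'⟩ := (Finset.ssubset_iff_of_subset h.1).1 h
  exact Finset.sum_lt_sum_of_subset h.1 hm hm' (by omega) (fun _ _ _ => Nat.zero_le _)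

lemma weight_pderiv_lt {f : MvPolynomial ι k} {y : ι} (h : y ∈ f.vars) :
    weight (pderiv y f) < weight f := by
  classical
  have hinj : Function.Injective fun n : ι →₀ ℕ => n + Finsupp.single y 1 :=
    add_left_injective _
  have hsub : (pderiv y f).support.image (fun m => m + Finsupp.single y 1) ⊆ f.support := by
    intro m hm
    obtain ⟨n, hn, rfl⟩ := Finset.mem_image.1 hm
    rw [mem_support_iff, coeff_pderiv] at hn
    exact mem_support_iff.2 (left_ne_zero_of_mul hn)
  have h1 : weight (pderiv y f) + (pderiv y f).support.card ≤ weight f := by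
    refine le_trans (le_of_eq ?_) (Finset.sum_le_sum_of_subset hsub)
    rw [Finset.sum_image (fun a _ b _ e => hinj e), weight, Finset.card_eq_sum_ones,
      ← Finset.sum_add_distrib]
    exact Finset.sum_congr rfl fun m _ => by simp; ring
  by_cases h0 : (pderiv y f).support = ∅
  · rw [weight, h0, Finset.sum_empty]
    obtain ⟨m, hm, -⟩ := (mem_vars_iff_mem_support y).1 h
    exact Finset.sum_pos (fun _ _ => by omega) ⟨m, hm⟩
  · have := Finset.card_pos.2 (Finset.nonempty_iff_ne_empty.2 h0)
    omega

variable [CharZero k]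

/-- A polynomial of an ideal `P` whose derivative in `x` is not in `P` can be replaced by one all
of whose derivatives, in the variables that it involves, are outside `P`. If `∂f/∂y ∈ P`, then
either `∂f/∂y` itself or the Euler combination `d f - y ∂f/∂y` is a smaller choice. -/
lemma exists_separable {P : Ideal (MvPolynomial ι k)} {x : ι} {f : MvPolynomial ι k}
    (hf : f ∈ P) (hx : pderiv x f ∉ P) :
    ∃ g ∈ P, pderiv x g ∉ P ∧ (∀ S : Set ι, f ∈ supported k S → g ∈ supported k S) ∧
      degreeOf x g ≤ degreeOf x f ∧ ∀ y ∈ g.vars, pderiv y g ∉ P := by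
  induction hn : weight f using Nat.strong_induction_on generalizing f with
  | _ n ih =>
    subst hn
    by_cases hall : ∀ y ∈ f.vars, pderiv y f ∉ P
    · exact ⟨f, hf, hx, fun S h => h, le_rfl, hall⟩
    push Not at hall
    obtain ⟨y, hy, hyP⟩ := hall
    by_cases hxy : pderiv x (pderiv y f) ∈ P
    · have hyx : x ≠ y := fun h => hx (h ▸ hyP)
      have hd : 0 < degreeOf y f := Nat.pos_of_ne_zero (mem_vars_iff_degreeOf_ne_zero.1 hy)
      have hd' : (degreeOf y f : k) ≠ 0 := by exact_mod_cast hd.ne'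
      have hsub := support_euler_subset f y (degreeOf y f)
      set g := C (degreeOf y f : k) * f - X y * pderiv y f with hg
      have hgP : g ∈ P := P.sub_mem (P.mul_mem_left _ hf) (P.mul_mem_left _ hyP)
      have hgx : pderiv x g ∉ P := by
        intro h
        apply hx
        have e : C (degreeOf y f : k) * pderiv x f = pderiv x g + X y * pderiv x (pderiv y f) := by
          rw [hg, map_sub, pderiv_C_mul, pderiv_mul, pderiv_X_of_ne hyx.symm]; ring
        have h2 : C (degreeOf y f : k) * pderiv x f ∈ P := by
          rw [e]; exact P.add_mem h (P.mul_mem_left _ hxy)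
        have h3 := P.mul_mem_left (C (degreeOf y f : k)⁻¹) h2
        rwa [← mul_assoc, ← C_mul, inv_mul_cancel₀ hd', C_1, one_mul] at h3
      have hss : g.support ⊂ f.support := by
        refine hsub.ssubset_of_ne fun he => ?_
        have h1 := degreeOf_euler_lt hd
        rw [← hg, degreeOf_eq_sup, degreeOf_eq_sup, he] at h1
        exact lt_irrefl _ h1
      obtain ⟨g', h1, h2, h3, h4, h5⟩ := ih _ (weight_lt_of_support_ssubset hss) hgP hgx rfl
      exact ⟨g', h1, h2, fun S hS => h3 S (mem_supported_of_support_subset hsub hS),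
        h4.trans (degreeOf_le_of_support_subset hsub x), h5⟩
    · obtain ⟨g', h1, h2, h3, h4, h5⟩ := ih _ (weight_pderiv_lt hy) hyP hxy rfl
      exact ⟨g', h1, h2, fun S hS => h3 S (pderiv_mem_supported y hS),
        h4.trans (degreeOf_pderiv_le f x y), h5⟩

/-- If the polynomials of `P` in the variables `insert x S`, of degree at most that of `r` in `x`,
have their derivative in `x` in `P`, then `r` lies in the ideal generated by the elements of `P` in
the variables `S`. -/
lemma mem_of_pderiv_mem {P J : Ideal (MvPolynomial ι k)} {S : Set ι} {x : ι}
    (hJ : ∀ g ∈ P, g ∈ supported k S → g ∈ J) {r : MvPolynomial ι k} (hr : r ∈ P)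
    (hrS : r ∈ supported k (insert x S))
    (hd : ∀ h ∈ P, h ∈ supported k (insert x S) → degreeOf x h ≤ degreeOf x r → pderiv x h ∈ P) :
    r ∈ J := by
  induction hn : degreeOf x r using Nat.strong_induction_on generalizing r with
  | _ n ih =>
    subst hn
    rcases Nat.eq_zero_or_pos (degreeOf x r) with h0 | hpos
    · refine hJ r hr (mem_supported.2 fun y hy => ?_)
      rcases mem_supported.1 hrS hy with rfl | h
      · exact absurd h0 (mem_vars_iff_degreeOf_ne_zero.1 hy)
      · exact h
    · have h1 : pderiv x r ∈ P := hd r hr hrS le_rfl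
      have h2 := degreeOf_pderiv_self_lt hpos
      have h3 := degreeOf_euler_lt hpos
      have key1 : pderiv x r ∈ J := ih _ h2 h1 (pderiv_mem_supported x hrS)
        (fun h a b c => hd h a b (c.trans h2.le)) rfl
      have key2 := ih _ h3 (P.sub_mem (P.mul_mem_left _ hr) (P.mul_mem_left _ h1))
        (mem_supported_of_support_subset (support_euler_subset r x _) hrS)
        (fun h a b c => hd h a b (c.trans h3.le)) rfl
      have hd' : (degreeOf x r : k) ≠ 0 := by exact_mod_cast hpos.ne'
      have e : r = C (degreeOf x r : k)⁻¹ *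
          ((C (degreeOf x r : k) * r - X x * pderiv x r) + X x * pderiv x r) := by
        rw [sub_add_cancel, ← mul_assoc, ← C_mul, inv_mul_cancel₀ hd', C_1, one_mul]
      rw [e]
      exact J.mul_mem_left _ (J.add_mem key2 (J.mul_mem_left _ key1))

end Calculus

/-! ### Initials and pseudo-division -/

section Initial

variable {k : Type*} {ι : Type*} [Field k] [LinearOrder ι]

lemma coeff_coeffIn (f : MvPolynomial ι k) (x : ι) (n : ℕ) (m : ι →₀ ℕ) :
    coeff m (coeffIn f x n) = if m x = 0 then coeff (m + Finsupp.single x n) f else 0 := by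
  classical
  rw [coeffIn, coeff_sum]
  simp only [coeff_monomial]
  have key : ∀ p : ι →₀ ℕ, (p x = n ∧ p.erase x = m) ↔ (m x = 0 ∧ p = m + Finsupp.single x n) := by
    intro p
    constructor
    · rintro ⟨h1, rfl⟩
      refine ⟨by simp, ?_⟩
      rw [← h1, Finsupp.erase_add_single]
    · rintro ⟨h1, rfl⟩
      refine ⟨by simp [h1], ?_⟩
      ext y
      by_cases h : y = x
      · subst h; simp [h1]
      · simp [Finsupp.erase_ne h]
  rw [Finset.sum_filter]
  simp only [← ite_and, key]
  by_cases h : m x = 0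
  · simp only [h, true_and, if_true]
    rw [Finset.sum_ite_eq']
    split_ifs with h2
    · rfl
    · exact (notMem_support_iff.1 h2).symm
  · simp [h]

lemma coeffIn_mem_supported {S : Set ι} {f : MvPolynomial ι k} (hf : f ∈ supported k S) (x : ι)
    (n : ℕ) : coeffIn f x n ∈ supported k (S \ {x}) := by
  classical
  rw [mem_supported]
  intro y hy
  obtain ⟨m, hm, hym⟩ := (mem_vars_iff_mem_support y).1 hy
  rw [mem_support_iff, coeff_coeffIn] at hm
  split_ifs at hm with h
  · have hyx : y ≠ x := by rintro rfl; exact Finsupp.mem_support_iff.1 hym h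
    refine ⟨mem_supported.1 hf ((mem_vars_iff_mem_support y).2 ⟨_, mem_support_iff.2 hm, ?_⟩), hyx⟩
    simp [Finsupp.mem_support_iff.1 hym]
  · exact absurd rfl hm

lemma support_sub_top_subset (f : MvPolynomial ι k) (x : ι) (n : ℕ) :
    ∀ m ∈ (f - coeffIn f x n * X x ^ n).support, m ∈ f.support ∧ m x ≠ n := by
  classical
  have e : coeffIn f x n * X x ^ n = ∑ m ∈ f.support with m x = n, monomial m (f.coeff m) := by
    rw [coeffIn, Finset.sum_mul]
    refine Finset.sum_congr rfl fun m hm => ?_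
    rw [X_pow_eq_monomial, monomial_mul, mul_one, ← (Finset.mem_filter.1 hm).2,
      Finsupp.erase_add_single]
  intro m hm
  rw [mem_support_iff, coeff_sub, e, coeff_sum] at hm
  simp only [coeff_monomial, Finset.sum_ite_eq', Finset.mem_filter] at hm
  by_cases h1 : m ∈ f.support
  · refine ⟨h1, fun h2 => ?_⟩
    rw [if_pos ⟨h1, h2⟩, sub_self] at hm
    exact hm rfl
  · rw [notMem_support_iff.1 h1] at hm
    simp at hm

lemma degreeOf_sub_top_lt {f : MvPolynomial ι k} {x : ι} (h : 0 < degreeOf x f) :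
    degreeOf x (f - coeffIn f x (degreeOf x f) * X x ^ degreeOf x f) < degreeOf x f := by
  rw [degreeOf_lt_iff h]
  intro m hm
  obtain ⟨h1, h2⟩ := support_sub_top_subset f x _ m hm
  exact lt_of_le_of_ne (monomial_le_degreeOf x h1) h2

lemma coeffIn_eq_self {f : MvPolynomial ι k} {x : ι} (h : degreeOf x f = 0) :
    coeffIn f x 0 = f := by
  classical
  have : f - coeffIn f x 0 * X x ^ 0 = 0 := by
    rw [← support_eq_empty, Finset.eq_empty_iff_forall_notMem]
    intro m hm
    obtain ⟨h1, h2⟩ := support_sub_top_subset f x _ m hm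
    have := monomial_le_degreeOf x h1
    omega
  rw [pow_zero, mul_one, sub_eq_zero] at this
  exact this.symm

/-- Reading off a coefficient from an expansion. -/
lemma coeffIn_eq {S : Set ι} {c g : MvPolynomial ι k} {x : ι} {n : ℕ} (hc : c ∈ supported k S)
    (hx : x ∉ S) (hg : degreeOf x g < n) :
    coeffIn (c * X x ^ n + g) x n = c := by
  classical
  ext m
  rw [coeff_coeffIn]
  split_ifs with h
  · rw [coeff_add, X_pow_eq_monomial, coeff_mul_monomial, mul_one, add_eq_left]
    by_contra hne
    have := (degreeOf_lt_iff (Nat.zero_lt_of_lt hg)).1 hg _ (mem_support_iff.2 hne)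
    simp at this
  · by_contra hne
    have h1 : x ∈ c.vars := (mem_vars_iff_mem_support x).2
      ⟨m, mem_support_iff.2 (Ne.symm hne), Finsupp.mem_support_iff.2 h⟩
    exact hx (mem_supported.1 hc h1)

lemma sub_top_eq_zero_or_lt (f : MvPolynomial ι k) (x : ι) :
    f - coeffIn f x (degreeOf x f) * X x ^ degreeOf x f = 0 ∨
      degreeOf x (f - coeffIn f x (degreeOf x f) * X x ^ degreeOf x f) < degreeOf x f := by
  rcases Nat.eq_zero_or_pos (degreeOf x f) with h | h
  · exact Or.inl (by rw [h, coeffIn_eq_self h, pow_zero, mul_one, sub_self])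
  · exact Or.inr (degreeOf_sub_top_lt h)

lemma coeffIn_mul {f g : MvPolynomial ι k} {x : ι} (h : 0 < degreeOf x f + degreeOf x g) :
    coeffIn (f * g) x (degreeOf x f + degreeOf x g) =
      coeffIn f x (degreeOf x f) * coeffIn g x (degreeOf x g) := by
  have hf := coeffIn_mem_supported (S := Set.univ) (f := f) (by simp) x (degreeOf x f)
  have hg := coeffIn_mem_supported (S := Set.univ) (f := g) (by simp) x (degreeOf x g)
  have hx : x ∉ (Set.univ : Set ι) \ {x} := by simp
  have hrf := sub_top_eq_zero_or_lt f x
  have hrg := sub_top_eq_zero_or_lt g x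
  set d := degreeOf x f with hd
  set e := degreeOf x g with he
  set a := coeffIn f x d
  set b := coeffIn g x e
  have e1 : f * g = a * b * X x ^ (d + e) +
      ((f - a * X x ^ d) * g + a * (X x ^ d * (g - b * X x ^ e))) := by
    rw [pow_add]; ring
  conv_lhs => rw [e1]
  refine coeffIn_eq (mul_mem hf hg) hx ((degreeOf_add_le _ _ _).trans_lt (max_lt ?_ ?_))
  · rcases hrf with h0 | h0
    · rw [h0, zero_mul, degreeOf_zero]; exact h
    · exact (degreeOf_mul_le _ _ _).trans_lt (by omega)
  · rcases hrg with h0 | h0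
    · rw [h0, mul_zero, mul_zero, degreeOf_zero]; exact h
    · refine (degreeOf_mul_le _ _ _).trans_lt ?_
      rw [degreeOf_eq_zero_of_mem_supported hf hx, zero_add]
      refine (degreeOf_mul_le _ _ _).trans_lt ?_
      rw [degreeOf_X_self_pow]
      omega

/-- Division with remainder after multiplication by a power of the initial of the divisor. -/
lemma exists_pseudo_division {S : Set ι} {f g : MvPolynomial ι k} {x : ι}
    (hd : 0 < degreeOf x f) (hf : f ∈ supported k S) (hg : g ∈ supported k S) :
    ∃ (N : ℕ) (q r : MvPolynomial ι k), r ∈ supported k S ∧ degreeOf x r < degreeOf x f ∧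
      coeffIn f x (degreeOf x f) ^ N * g = q * f + r := by
  induction hn : degreeOf x g using Nat.strong_induction_on generalizing g with
  | _ n ih =>
    subst hn
    by_cases hlt : degreeOf x g < degreeOf x f
    · exact ⟨0, 0, g, hg, hlt, by simp⟩
    push Not at hlt
    set d := degreeOf x f with hdd
    set e := degreeOf x g with hee
    set i := coeffIn f x d with hi
    set c := coeffIn g x e with hc
    have hi' : i ∈ supported k (S \ {x}) := coeffIn_mem_supported hf x d
    have hc' : c ∈ supported k (S \ {x}) := coeffIn_mem_supported hg x e
    have hxS : x ∉ S \ {x} := by simp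
    have hi0 := degreeOf_eq_zero_of_mem_supported hi' hxS
    have hc0 := degreeOf_eq_zero_of_mem_supported hc' hxS
    have hdvars : x ∈ S := mem_supported.1 hf (mem_vars_iff_degreeOf_ne_zero.2 hd.ne')
    have hX : (X x : MvPolynomial ι k) ∈ supported k S := X_mem_supported.2 hdvars
    have hiS : i ∈ supported k S := supported_mono Set.sdiff_subset hi'
    have hcS : c ∈ supported k S := supported_mono Set.sdiff_subset hc'
    have key : i * g - c * X x ^ (e - d) * f
        = i * (g - c * X x ^ e) - c * (X x ^ (e - d) * (f - i * X x ^ d)) := by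
      have : (X x : MvPolynomial ι k) ^ e = X x ^ (e - d) * X x ^ d := by
        rw [← pow_add, Nat.sub_add_cancel hlt]
      rw [this]; ring
    have hlt' : degreeOf x (i * g - c * X x ^ (e - d) * f) < e := by
      rw [key]
      refine (degreeOf_sub_le _ _ _).trans_lt (max_lt ?_ ?_)
      · refine (degreeOf_mul_le _ _ _).trans_lt ?_
        rw [hi0, zero_add]
        exact degreeOf_sub_top_lt (hd.trans_le hlt)
      · refine (degreeOf_mul_le _ _ _).trans_lt ?_
        rw [hc0, zero_add]
        refine (degreeOf_mul_le _ _ _).trans_lt ?_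
        rw [degreeOf_X_self_pow]
        have := degreeOf_sub_top_lt hd
        rw [← hdd, ← hi] at this
        omega
    obtain ⟨N, q, r, h1, h2, h3⟩ := ih _ hlt' (sub_mem (mul_mem hiS hg)
      (mul_mem (mul_mem hcS (pow_mem hX _)) hf)) rfl
    refine ⟨N + 1, q + i ^ N * (c * X x ^ (e - d)), r, h1, h2, ?_⟩
    linear_combination h3

end Initial

/-! ### Complete lists of a prime ideal in finitely many variables -/

section CompleteList

variable {k : Type*} {ι : Type*} [Field k] [LinearOrder ι]

lemma polyUpperLeader_eq {f : MvPolynomial ι k} {x : ι} (hf : f.vars.Nonempty) (hx : x ∈ f.vars)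
    (h : ∀ y ∈ f.vars, y ≤ x) : polyUpperLeader f hf = x :=
  le_antisymm (Finset.max'_le _ _ _ h) (Finset.le_max' _ _ hx)

lemma polyLowerLeader_eq {f : MvPolynomial ι k} {x : ι} (hf : f.vars.Nonempty) (hx : x ∈ f.vars)
    (h : ∀ y ∈ f.vars, x ≤ y) : polyLowerLeader f hf = x :=
  le_antisymm (Finset.min'_le _ _ hx) (Finset.le_min' _ _ _ h)

lemma upperInitial_eq {f : MvPolynomial ι k} {x : ι} (hx : x ∈ f.vars)
    (h : ∀ y ∈ f.vars, y ≤ x) : upperInitial f = coeffIn f x (degreeOf x f) := by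
  rw [upperInitial, dif_pos ⟨x, hx⟩, polyUpperLeader_eq ⟨x, hx⟩ hx h]

lemma upperSeparant_eq {f : MvPolynomial ι k} {x : ι} (hx : x ∈ f.vars)
    (h : ∀ y ∈ f.vars, y ≤ x) : upperSeparant f = pderiv x f := by
  rw [upperSeparant, dif_pos ⟨x, hx⟩, polyUpperLeader_eq ⟨x, hx⟩ hx h]

lemma lowerSeparant_eq {f : MvPolynomial ι k} {x : ι} (hx : x ∈ f.vars)
    (h : ∀ y ∈ f.vars, x ≤ y) : lowerSeparant f = pderiv x f := by
  rw [lowerSeparant, dif_pos ⟨x, hx⟩, polyLowerLeader_eq ⟨x, hx⟩ hx h]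

lemma initSep_cons (f : MvPolynomial ι k) (Λ : List (MvPolynomial ι k)) :
    initSep (f :: Λ) = upperInitial f * (upperSeparant f * lowerSeparant f) * initSep Λ := by
  simp [initSep, separant]

/-- The variables of `g` lie between the leaders of `f`, and `g` has smaller degree than `f` in the
upper leader of `f`. -/
def IsNested (f g : MvPolynomial ι k) : Prop :=
  ∀ hf : f.vars.Nonempty,
    (∀ y ∈ g.vars, polyLowerLeader f hf ≤ y ∧ y ≤ polyUpperLeader f hf) ∧
      degreeOf (polyUpperLeader f hf) g < degreeOf (polyUpperLeader f hf) f

/-- A nested list of elements of `P` in the variables `I`, with initials and separants outside `P`,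
which determines the part of `P` in the variables `I`: that part is contained in every ideal that
contains the list and is saturated with respect to its initials and separants. -/
structure IsCompleteList (P : Ideal (MvPolynomial ι k)) (I : Set ι)
    (Λ : List (MvPolynomial ι k)) : Prop where
  mem : ∀ f ∈ Λ, f ∈ P
  mem_adjoin : ∀ f ∈ Λ, f ∈ supported k I
  nonempty : ∀ f ∈ Λ, f.vars.Nonempty
  initSep_notMem : initSep Λ ∉ P
  nested : Λ.Pairwise IsNested
  complete : ∀ J : Ideal (MvPolynomial ι k), (∀ f ∈ Λ, f ∈ J) →
    (∀ y, initSep Λ * y ∈ J → y ∈ J) → ∀ g ∈ P, g ∈ supported k I → g ∈ J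

/-- The initial of a polynomial of least positive degree is outside `P`, as its leading term could
be dropped otherwise. -/
lemma coeffIn_notMem_of_minimal {P : Ideal (MvPolynomial ι k)} {S : Set ι} {x : ι}
    {f : MvPolynomial ι k} (hf : f ∈ P) (hfS : f ∈ supported k S) (hx : pderiv x f ∉ P)
    (hmin : ∀ g ∈ P, g ∈ supported k S → pderiv x g ∉ P → degreeOf x f ≤ degreeOf x g) :
    coeffIn f x (degreeOf x f) ∉ P := by
  intro hc
  have hxv := mem_vars_of_pderiv_notMem hx
  have hd := Nat.pos_of_ne_zero (mem_vars_iff_degreeOf_ne_zero.1 hxv)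
  have hcS := coeffIn_mem_supported hfS x (degreeOf x f)
  have hlt := degreeOf_sub_top_lt hd
  have h0 : pderiv x (coeffIn f x (degreeOf x f)) = 0 :=
    pderiv_eq_zero_of_mem_supported hcS (by simp)
  refine absurd (hmin _ (P.sub_mem hf (P.mul_mem_right _ hc)) (sub_mem hfS (mul_mem
    (supported_mono Set.sdiff_subset hcS)
    (pow_mem (X_mem_supported.2 (mem_supported.1 hfS hxv)) _)))
    fun h => hx ?_) (not_le.2 hlt)
  rw [map_sub, pderiv_mul, h0, zero_mul, zero_add] at h
  have := P.add_mem h (P.mul_mem_right (pderiv x (X x ^ degreeOf x f)) hc)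
  rwa [sub_add_cancel] at this

variable [CharZero k]

/-- Enlarging the set of variables by a new largest variable. If `P` has a polynomial that really
depends on the new variable, one of least degree is added in front of the list; adding the previous
first polynomial to it, if necessary, makes its range of variables large enough. -/
lemma IsCompleteList.exists_insert {P : Ideal (MvPolynomial ι k)} (hP : P.IsPrime) {I : Set ι}
    {x : ι} (hxI : ∀ y ∈ I, y < x) {Λ : List (MvPolynomial ι k)} (hΛ : IsCompleteList P I Λ) :
    ∃ Λ', IsCompleteList P (insert x I) Λ' := by
  have hxI' : x ∉ I := fun h => lt_irrefl _ (hxI x h)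
  by_cases hex : ∃ f ∈ P, f ∈ supported k (insert x I) ∧ pderiv x f ∉ P
  swap
  · push Not at hex
    exact ⟨Λ, hΛ.mem, fun f hf => supported_mono (Set.subset_insert _ _) (hΛ.mem_adjoin f hf),
      hΛ.nonempty, hΛ.initSep_notMem, hΛ.nested, fun J h1 h2 g hg hgS =>
      mem_of_pderiv_mem (hΛ.complete J h1 h2) hg hgS fun h a b _ => hex h a b⟩
  -- A polynomial of least degree in `x`, all of whose derivatives are nonzero modulo `P`.
  obtain ⟨f₁, ⟨hf₁P, hf₁S, hf₁x⟩, hmin₁⟩ : ∃ f, (f ∈ P ∧ f ∈ supported k (insert x I) ∧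
      pderiv x f ∉ P) ∧ ∀ g ∈ P, g ∈ supported k (insert x I) → pderiv x g ∉ P →
        degreeOf x f ≤ degreeOf x g := by
    obtain ⟨f, hf, hmin⟩ := WellFounded.has_min (measure (degreeOf x)).wf
      {f | f ∈ P ∧ f ∈ supported k (insert x I) ∧ pderiv x f ∉ P} hex
    exact ⟨f, hf, fun g h1 h2 h3 => not_lt.1 (hmin g ⟨h1, h2, h3⟩)⟩
  obtain ⟨f₂, hf₂P, hf₂x, hf₂S, hf₂d, hf₂v⟩ := exists_separable hf₁P hf₁x
  replace hf₂S := hf₂S _ hf₁S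
  have hmin₂ : ∀ g ∈ P, g ∈ supported k (insert x I) → pderiv x g ∉ P →
      degreeOf x f₂ ≤ degreeOf x g := fun g a b c => hf₂d.trans (hmin₁ g a b c)
  have hx₂ := mem_vars_of_pderiv_notMem hf₂x
  obtain ⟨f, hfP, hfS, hfx, hmin, a, hafv, haf, hale, haΛ⟩ : ∃ f ∈ P,
      f ∈ supported k (insert x I) ∧ pderiv x f ∉ P ∧
      (∀ g ∈ P, g ∈ supported k (insert x I) → pderiv x g ∉ P → degreeOf x f ≤ degreeOf x g) ∧
      ∃ a ∈ f.vars, pderiv a f ∉ P ∧ (∀ y ∈ f.vars, a ≤ y) ∧ ∀ g ∈ Λ, ∀ y ∈ g.vars, a ≤ y := by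
    set b := f₂.vars.min' ⟨x, hx₂⟩ with hb
    have hbv : b ∈ f₂.vars := Finset.min'_mem _ _
    have hble : ∀ y ∈ f₂.vars, b ≤ y := fun y hy => Finset.min'_le _ _ hy
    by_cases hall : ∀ g ∈ Λ, ∀ y ∈ g.vars, b ≤ y
    · exact ⟨f₂, hf₂P, hf₂S, hf₂x, hmin₂, b, hbv, hf₂v b hbv, hble, hall⟩
    push Not at hall
    obtain ⟨g, hg, y, hy, hyb⟩ := hall
    cases Λ with
    | nil => simp at hg
    | cons f₀ Λ₀ =>
      have hne := hΛ.nonempty f₀ (by simp)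
      set a := polyLowerLeader f₀ hne with ha
      have hav : a ∈ f₀.vars := Finset.min'_mem _ _
      have hale : ∀ y ∈ f₀.vars, a ≤ y := fun y hy => Finset.min'_le _ _ hy
      have haΛ : ∀ g ∈ f₀ :: Λ₀, ∀ y ∈ g.vars, a ≤ y := by
        intro g hg y hy
        rcases List.mem_cons.1 hg with rfl | hg
        · exact hale y hy
        · exact (((List.pairwise_cons.1 hΛ.nested).1 g hg hne).1 y hy).1
      have hab : a < b := (haΛ g hg y hy).trans_lt hyb
      have hf₀S := hΛ.mem_adjoin f₀ (by simp)
      have hf₀P := hΛ.mem f₀ (by simp)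
      have hf₀a : pderiv a f₀ ∉ P := by
        intro h
        apply hΛ.initSep_notMem
        rw [initSep_cons, lowerSeparant_eq hav hale]
        exact P.mul_mem_right _ (P.mul_mem_left _ (P.mul_mem_left _ h))
      have hdx : pderiv x (f₂ + f₀) = pderiv x f₂ := by
        rw [map_add, pderiv_eq_zero_of_mem_supported hf₀S hxI', add_zero]
      have hda : pderiv a (f₂ + f₀) = pderiv a f₀ := by
        rw [map_add, pderiv_eq_zero_of_notMem_vars fun h => absurd (hble a h) (not_le.2 hab),
          zero_add]
      refine ⟨f₂ + f₀, P.add_mem hf₂P hf₀P, add_mem hf₂S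
        (supported_mono (Set.subset_insert _ _) hf₀S), by rwa [hdx], fun g h1 h2 h3 =>
        ((degreeOf_add_le _ _ _).trans (max_le le_rfl ?_)).trans (hmin₂ g h1 h2 h3), a,
        mem_vars_of_pderiv_notMem (P := P) (by rwa [hda]), by rwa [hda], ?_, haΛ⟩
      · rw [degreeOf_eq_zero_of_mem_supported hf₀S hxI']; exact Nat.zero_le _
      · intro y hy
        rcases Finset.mem_union.1 (vars_add_subset _ _ hy) with h | h
        · exact hab.le.trans (hble y h)
        · exact hale y h
  have hxv := mem_vars_of_pderiv_notMem hfx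
  have hlex : ∀ y ∈ f.vars, y ≤ x := by
    intro y hy
    rcases mem_supported.1 hfS hy with rfl | h
    · exact le_rfl
    · exact (hxI y h).le
  have hd := Nat.pos_of_ne_zero (mem_vars_iff_degreeOf_ne_zero.1 hxv)
  have hi := coeffIn_notMem_of_minimal hfP hfS hfx hmin
  have hiS : initSep (f :: Λ) = coeffIn f x (degreeOf x f) * (pderiv x f * pderiv a f) *
      initSep Λ := by
    rw [initSep_cons, upperInitial_eq hxv hlex, upperSeparant_eq hxv hlex,
      lowerSeparant_eq hafv hale]
  refine ⟨f :: Λ, ?_, ?_, ?_, ?_, ?_, ?_⟩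
  · simpa using ⟨hfP, hΛ.mem⟩
  · simpa using ⟨hfS, fun g hg => supported_mono (Set.subset_insert _ _) (hΛ.mem_adjoin g hg)⟩
  · simpa using ⟨⟨x, hxv⟩, hΛ.nonempty⟩
  · rw [hiS]
    exact hP.mul_notMem (hP.mul_notMem hi (hP.mul_notMem hfx haf)) hΛ.initSep_notMem
  · refine List.pairwise_cons.2 ⟨fun g hg hne => ?_, hΛ.nested⟩
    rw [polyUpperLeader_eq hne hxv hlex, polyLowerLeader_eq hne hafv hale]
    have hgS := hΛ.mem_adjoin g hg
    refine ⟨fun y hy => ⟨haΛ g hg y hy, (hxI y (mem_supported.1 hgS hy)).le⟩, ?_⟩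
    rw [degreeOf_eq_zero_of_mem_supported hgS hxI']
    exact hd
  · intro J hJ hsat g hg hgS
    have hJΛ : ∀ g ∈ P, g ∈ supported k I → g ∈ J := by
      refine hΛ.complete J (fun g hg => hJ g (by simp [hg])) fun y hy => hsat y ?_
      rw [hiS, mul_assoc]
      exact J.mul_mem_left _ hy
    have hsati : ∀ (N : ℕ) y, coeffIn f x (degreeOf x f) ^ N * y ∈ J → y ∈ J := by
      intro N
      induction N with
      | zero => intro y hy; simpa using hy
      | succ N ih =>
        intro y hy
        refine ih y (hsat _ ?_)
        have : initSep (f :: Λ) * (coeffIn f x (degreeOf x f) ^ N * y) =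
            (pderiv x f * pderiv a f * initSep Λ) *
              (coeffIn f x (degreeOf x f) ^ (N + 1) * y) := by
          rw [hiS]; ring
        rw [this]
        exact J.mul_mem_left _ hy
    obtain ⟨N, q, r, hrS, hrd, e⟩ := exists_pseudo_division hd hfS hgS
    have hfJ : f ∈ J := hJ f (by simp)
    have hrP : r ∈ P := by
      have : r = coeffIn f x (degreeOf x f) ^ N * g - q * f := by rw [e]; ring
      rw [this]
      exact P.sub_mem (P.mul_mem_left _ hg) (P.mul_mem_left _ hfP)
    have hrJ : r ∈ J := by
      refine mem_of_pderiv_mem hJΛ hrP hrS fun h h1 h2 h3 => ?_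
      by_contra h4
      exact absurd (hmin h h1 h2 h4) (not_le.2 (h3.trans_lt hrd))
    refine hsati N g ?_
    rw [e]
    exact J.add_mem (J.mul_mem_left _ hfJ) hrJ

lemma exists_isCompleteList {P : Ideal (MvPolynomial ι k)} (hP : P.IsPrime) (I : Finset ι) :
    ∃ Λ, IsCompleteList P (I : Set ι) Λ := by
  induction I using Finset.induction_on_max with
  | empty =>
    refine ⟨[], by simp, by simp, by simp, ?_, by simp, fun J _ _ g hg hgS => ?_⟩
    · simpa [initSep] using (Ideal.ne_top_iff_one P).1 hP.ne_top
    · rw [Finset.coe_empty, supported_empty, Algebra.mem_bot] at hgS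
      obtain ⟨c, rfl⟩ := hgS
      by_cases hc : c = 0
      · simp [hc]
      · exact absurd (P.eq_top_of_isUnit_mem hg
          ((IsUnit.mk0 c hc).map (algebraMap k (MvPolynomial ι k)))) hP.ne_top
  | insert x I hx ih =>
    obtain ⟨Λ, hΛ⟩ := ih
    rw [Finset.coe_insert]
    exact hΛ.exists_insert hP hx

omit [CharZero k] in
/-- A variable on which `P ∩ k[I]` really depends belongs to every set `S` of variables that
suffices to write a complete list: the derivative in any other variable preserves the ideal of the
list. -/
lemma IsCompleteList.mem_range_of_pderiv_notMem {P : Ideal (MvPolynomial ι k)} (hP : P.IsPrime)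
    {I S : Set ι} {Λ : List (MvPolynomial ι k)} (hΛ : IsCompleteList P I Λ)
    (hS : ∀ f ∈ Λ, f ∈ supported k S) {h : MvPolynomial ι k} (hh : h ∈ P)
    (hhI : h ∈ supported k I) {y : ι} (hy : pderiv y h ∉ P) : y ∈ S := by
  by_contra hyS
  have hsS : initSep Λ ∈ supported k S := by
    refine list_prod_mem fun g hg => ?_
    obtain ⟨f, hf, rfl⟩ := List.mem_map.1 hg
    have hfS := hS f hf
    have hne := hΛ.nonempty f hf
    rw [separant, upperInitial, upperSeparant, lowerSeparant, dif_pos hne, dif_pos hne,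
      dif_pos hne]
    exact mul_mem (supported_mono Set.sdiff_subset (coeffIn_mem_supported hfS _ _))
      (mul_mem (pderiv_mem_supported _ hfS) (pderiv_mem_supported _ hfS))
  set I₀ := Ideal.span {f | f ∈ Λ} with hI₀
  have hI₀P : I₀ ≤ P := Ideal.span_le.2 hΛ.mem
  -- The derivative in a variable foreign to the list preserves the ideal that it generates.
  have hder : ∀ g ∈ I₀, pderiv y g ∈ I₀ := by
    intro g hg
    induction hg using Submodule.span_induction with
    | mem f hf =>
      rw [pderiv_eq_zero_of_mem_supported (hS f hf) hyS]
      exact I₀.zero_mem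
    | zero => simp
    | add f g _ _ hf hg => rw [map_add]; exact I₀.add_mem hf hg
    | smul c f hf' hf =>
      rw [smul_eq_mul, pderiv_mul]
      exact I₀.add_mem (I₀.mul_mem_left _ hf') (I₀.mul_mem_left _ hf)
  obtain ⟨n, hn⟩ : h ∈ divInfinity I₀ (initSep Λ) := by
    refine hΛ.complete (divInfinity I₀ (initSep Λ)) (fun f hf => ⟨0, ?_⟩) (fun z hz => ?_) h hh hhI
    · rw [pow_zero, mul_one]; exact Ideal.subset_span hf
    · obtain ⟨n, hn⟩ := hz
      exact ⟨n + 1, by rw [pow_succ']; convert hn using 1; ring⟩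
  have h1 := hder _ hn
  rw [pderiv_mul, pderiv_eq_zero_of_mem_supported (pow_mem hsS n) hyS, mul_zero, add_zero] at h1
  rcases hP.mem_or_mem (hI₀P h1) with h2 | h2
  · exact hy h2
  · exact hΛ.initSep_notMem (hP.mem_of_pow_mem n h2)

/-- A complete list can be chosen so that ideals saturated with respect to its initials and
separants are saturated with respect to a given `m ∉ P`. To this end a multiple `g` of the first
polynomial `f₀` is put in front: modulo `f₀`, the separant of `g` is a multiple of `m`. -/
lemma exists_isCompleteList_saturated {P : Ideal (MvPolynomial ι k)} (hP : P.IsPrime)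
    (I : Finset ι) {m : MvPolynomial ι k} (hmP : m ∉ P)
    (hm : ∀ y ∈ m.vars, ∃ h ∈ P, h ∈ supported k (I : Set ι) ∧ pderiv y h ∉ P) :
    ∃ Λ, IsCompleteList P (I : Set ι) Λ ∧ ∀ J : Ideal (MvPolynomial ι k), (∀ f ∈ Λ, f ∈ J) →
      (∀ y, initSep Λ * y ∈ J → y ∈ J) → ∀ y, m * y ∈ J → y ∈ J := by
  obtain ⟨Λ, hΛ⟩ := exists_isCompleteList hP I
  cases Λ with
  | nil =>
    refine ⟨[], hΛ, fun J _ _ y hy => ?_⟩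
    have hvars : m ∈ supported k (∅ : Set ι) := by
      refine mem_supported.2 fun y hy => ?_
      obtain ⟨h, h1, h2, h3⟩ := hm y hy
      exact hΛ.mem_range_of_pderiv_notMem hP (by simp) h1 h2 h3
    rw [supported_empty, Algebra.mem_bot] at hvars
    obtain ⟨c, rfl⟩ := hvars
    have hc : c ≠ 0 := by rintro rfl; simp at hmP
    have h2 := J.mul_mem_left (algebraMap k _ c⁻¹) hy
    rwa [← mul_assoc, ← map_mul, inv_mul_cancel₀ hc, map_one, one_mul] at h2
  | cons f₀ Λ₀ =>
    have hne := hΛ.nonempty f₀ (by simp)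
    set x := polyUpperLeader f₀ hne with hx
    set a := polyLowerLeader f₀ hne with ha
    have hxv : x ∈ f₀.vars := Finset.max'_mem _ _
    have hav : a ∈ f₀.vars := Finset.min'_mem _ _
    have hlex : ∀ y ∈ f₀.vars, y ≤ x := fun y hy => Finset.le_max' _ _ hy
    have hale : ∀ y ∈ f₀.vars, a ≤ y := fun y hy => Finset.min'_le _ _ hy
    set S : Set ι := {y | a ≤ y ∧ y ≤ x} with hS
    have hrange : ∀ f ∈ f₀ :: Λ₀, f ∈ supported k S := by
      intro f hf
      refine mem_supported.2 fun y hy => ?_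
      rcases List.mem_cons.1 hf with rfl | hf
      · exact ⟨hale y hy, hlex y hy⟩
      · exact (((List.pairwise_cons.1 hΛ.nested).1 f hf hne).1 y hy)
    have hinit := hΛ.initSep_notMem
    rw [initSep_cons, upperInitial_eq hxv hlex, upperSeparant_eq hxv hlex,
      lowerSeparant_eq hav hale] at hinit
    have hi₀ : coeffIn f₀ x (degreeOf x f₀) ∉ P := fun h =>
      hinit (P.mul_mem_right _ (P.mul_mem_right _ h))
    have hsx₀ : pderiv x f₀ ∉ P := fun h =>
      hinit (P.mul_mem_right _ (P.mul_mem_left _ (P.mul_mem_right _ h)))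
    have hsa₀ : pderiv a f₀ ∉ P := fun h =>
      hinit (P.mul_mem_right _ (P.mul_mem_left _ (P.mul_mem_left _ h)))
    have hf₀P := hΛ.mem f₀ (by simp)
    have hf₀I := hΛ.mem_adjoin f₀ (by simp)
    have hf₀S := hrange f₀ (by simp)
    have hmSI : m ∈ supported k (S ∩ I) := by
      refine mem_supported.2 fun y hy => ?_
      obtain ⟨h, h1, h2, h3⟩ := hm y hy
      exact ⟨hΛ.mem_range_of_pderiv_notMem hP hrange h1 h2 h3,
        mem_supported.1 h2 (mem_vars_of_pderiv_notMem h3)⟩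
    have hxSI : x ∈ S ∩ I := ⟨mem_supported.1 hf₀S hxv, mem_supported.1 hf₀I hxv⟩
    have hXSI : (X x : MvPolynomial ι k) ∈ supported k (S ∩ I) := X_mem_supported.2 hxSI
    -- A representative `m'` of `m` modulo `P` of least degree in `x`; its initial is outside `P`.
    obtain ⟨m', ⟨hm'S, hm'P⟩, hmin⟩ := WellFounded.has_min (measure (degreeOf x)).wf
      {m' | m' ∈ supported k (S ∩ I) ∧ m' - m ∈ P} ⟨m, hmSI, by simp⟩
    have hm'notP : m' ∉ P := fun h => hmP (by simpa using P.sub_mem h hm'P)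
    set e := degreeOf x m' with he
    have hcS := coeffIn_mem_supported hm'S x e
    have hcP : coeffIn m' x e ∉ P := by
      intro hc
      rcases Nat.eq_zero_or_pos e with h0 | hpos
      · rw [h0, coeffIn_eq_self h0] at hc
        exact hm'notP hc
      · refine hmin (m' - coeffIn m' x e * X x ^ e) ⟨sub_mem hm'S (mul_mem
          (supported_mono Set.sdiff_subset hcS) (pow_mem hXSI _)), ?_⟩ (degreeOf_sub_top_lt hpos)
        rw [sub_right_comm]
        exact P.sub_mem hm'P (P.mul_mem_right _ hc)
    obtain ⟨c₀, hc₀⟩ : ∃ c : k, X x + C c ∉ P := by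
      by_contra! h
      refine hP.ne_top ((Ideal.eq_top_iff_one P).2 ?_)
      simpa using P.sub_mem (h 1) (h 0)
    set u : MvPolynomial ι k := X x + C c₀ with hu
    have huS : u ∈ supported k (S ∩ I) := add_mem hXSI (Subalgebra.algebraMap_mem _ c₀)
    set d := degreeOf x f₀ with hd
    have hdpos : 0 < d := Nat.pos_of_ne_zero (mem_vars_iff_degreeOf_ne_zero.1 hxv)
    have hf₀SI : f₀ ∈ supported k (S ∩ I) :=
      mem_supported.2 fun y hy => ⟨mem_supported.1 hf₀S hy, mem_supported.1 hf₀I hy⟩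
    have hiS := coeffIn_mem_supported hf₀SI x d
    set g := m' * u * f₀ with hg
    have hgP : g ∈ P := P.mul_mem_left _ hf₀P
    have hgS : g ∈ supported k (S ∩ I) := mul_mem (mul_mem hm'S huS) hf₀SI
    have hmu : m' * u ∉ P := hP.mul_notMem hm'notP hc₀
    have hder : ∀ y, pderiv y g = pderiv y (m' * u) * f₀ + m' * u * pderiv y f₀ := fun y => by
      rw [hg, pderiv_mul]
    have hder' : ∀ y, pderiv y f₀ ∉ P → pderiv y g ∉ P := by
      intro y hy h
      rw [hder] at h
      refine hP.mul_notMem hmu hy ?_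
      have := P.sub_mem h (P.mul_mem_left (pderiv y (m' * u)) hf₀P)
      rwa [add_sub_cancel_left] at this
    have hgxv := mem_vars_of_pderiv_notMem (hder' x hsx₀)
    have hgav := mem_vars_of_pderiv_notMem (hder' a hsa₀)
    have hglex : ∀ y ∈ g.vars, y ≤ x := fun y hy => (mem_supported.1 hgS hy).1.2
    have hgale : ∀ y ∈ g.vars, a ≤ y := fun y hy => (mem_supported.1 hgS hy).1.1
    have hne0 : ∀ {z : MvPolynomial ι k}, z ∉ P → z ≠ 0 := fun h h0 => h (h0 ▸ P.zero_mem)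
    have hdegu : degreeOf x u = 1 := by
      rw [hu, degreeOf_add_eq_of_degreeOf_lt] <;> simp
    have hf₀0 : f₀ ≠ 0 := by rintro h0; simp [h0] at hxv
    have hdegg : degreeOf x g = e + 1 + d := by
      rw [hg, degreeOf_mul_eq (hne0 hmu) hf₀0, degreeOf_mul_eq (hne0 hm'notP) (hne0 hc₀), hdegu]
    have hcu : coeffIn u x 1 = 1 := by
      have := coeffIn_eq (S := (∅ : Set ι)) (c := 1) (g := C c₀) (x := x) (n := 1) (one_mem _)
        (by simp) (by simp)
      rwa [one_mul, pow_one] at this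
    have hcg : coeffIn g x (degreeOf x g) = coeffIn m' x e * coeffIn f₀ x d := by
      have h1 := coeffIn_mul (f := u) (g := f₀) (x := x) (by omega)
      have h2 := coeffIn_mul (f := m') (g := u * f₀) (x := x) (by
        rw [degreeOf_mul_eq (hne0 hc₀) hf₀0]; omega)
      rw [degreeOf_mul_eq (hne0 hc₀) hf₀0, h1, hdegu, hcu, one_mul] at h2
      rw [hdegg, hg, mul_assoc, add_assoc]
      exact h2
    have hiSg : initSep (g :: f₀ :: Λ₀) = coeffIn m' x e * coeffIn f₀ x d *
        (pderiv x g * pderiv a g) * initSep (f₀ :: Λ₀) := by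
      rw [initSep_cons, upperInitial_eq hgxv hglex, upperSeparant_eq hgxv hglex,
        lowerSeparant_eq hgav hgale, hcg]
    have hsat₀ : ∀ J : Ideal (MvPolynomial ι k), (∀ y, initSep (g :: f₀ :: Λ₀) * y ∈ J → y ∈ J) →
        ∀ y, initSep (f₀ :: Λ₀) * y ∈ J → y ∈ J := by
      intro J hJ y hy
      refine hJ y ?_
      rw [hiSg, mul_assoc]
      exact J.mul_mem_left _ hy
    refine ⟨g :: f₀ :: Λ₀, ⟨?_, ?_, ?_, ?_, ?_, ?_⟩, ?_⟩
    · intro f hf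
      rcases List.mem_cons.1 hf with rfl | hf
      exacts [hgP, hΛ.mem f hf]
    · intro f hf
      rcases List.mem_cons.1 hf with rfl | hf
      exacts [supported_mono Set.inter_subset_right hgS, hΛ.mem_adjoin f hf]
    · intro f hf
      rcases List.mem_cons.1 hf with rfl | hf
      exacts [⟨x, hgxv⟩, hΛ.nonempty f hf]
    · rw [hiSg]
      exact hP.mul_notMem (hP.mul_notMem (hP.mul_notMem hcP hi₀)
        (hP.mul_notMem (hder' x hsx₀) (hder' a hsa₀))) hΛ.initSep_notMem
    · refine List.pairwise_cons.2 ⟨fun f hf hgne => ?_, hΛ.nested⟩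
      rw [polyUpperLeader_eq hgne hgxv hglex, polyLowerLeader_eq hgne hgav hgale]
      refine ⟨fun y hy => mem_supported.1 (hrange f hf) hy, ?_⟩
      have : degreeOf x f ≤ d := by
        rcases List.mem_cons.1 hf with rfl | hf
        · exact le_rfl
        · exact ((List.pairwise_cons.1 hΛ.nested).1 f hf hne).2.le
      omega
    · exact fun J hJ hsat => hΛ.complete J (fun f hf => hJ f (List.mem_cons_of_mem _ hf))
        (hsat₀ J hsat)
    · intro J hJ hsat y hy
      have hfJ : f₀ ∈ J := hJ f₀ (by simp)
      have hmm : m' - m ∈ J := hΛ.complete J (fun f hf => hJ f (List.mem_cons_of_mem _ hf))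
        (hsat₀ J hsat) _ hm'P (sub_mem (supported_mono Set.inter_subset_right hm'S)
          (supported_mono Set.inter_subset_right hmSI))
      refine hsat y ?_
      have h1 : m' * y ∈ J := by
        have := J.add_mem (J.mul_mem_right y hmm) hy
        rwa [← add_mul, sub_add_cancel] at this
      have h2 : pderiv x g * y ∈ J := by
        have e1 : pderiv x g * y =
            pderiv x (m' * u) * y * f₀ + u * pderiv x f₀ * (m' * y) := by
          rw [hder]; ring
        rw [e1]
        exact J.add_mem (J.mul_mem_left _ hfJ) (J.mul_mem_left _ h1)
      have e2 : initSep (g :: f₀ :: Λ₀) * y = coeffIn m' x e * coeffIn f₀ x d * pderiv a g *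
          initSep (f₀ :: Λ₀) * (pderiv x g * y) := by
        rw [hiSg]; ring
      rw [e2]
      exact J.mul_mem_left _ h2

end CompleteList

/-! ### Elimination of variables -/

section Elimination

variable {k : Type*} {ι : Type*} [Field k]

/-- A relation of degree one in the variable `K` eliminates `K` from a polynomial, up to a power of
its leading coefficient. -/
lemma exists_eliminate {W : Set ι} {K : ι} {s T g : MvPolynomial ι k} (hs : s ∈ supported k W)
    (hT : T ∈ supported k W) (hg : g ∈ supported k (insert K W)) :
    ∃ (N : ℕ) (q r : MvPolynomial ι k), r ∈ supported k W ∧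
      s ^ N * g = q * (s * X K + T) + r := by
  rw [supported_eq_adjoin_X] at hg
  induction hg using Algebra.adjoin_induction with
  | mem x hx =>
    obtain ⟨i, rfl | hi, rfl⟩ := hx
    · exact ⟨1, 1, -T, neg_mem hT, by ring⟩
    · exact ⟨0, 0, X i, X_mem_supported.2 hi, by ring⟩
  | algebraMap c => exact ⟨0, 0, _, Subalgebra.algebraMap_mem _ c, by ring⟩
  | add x y _ _ hx hy =>
    obtain ⟨N, q, r, hr, e⟩ := hx
    obtain ⟨M, q', r', hr', e'⟩ := hy
    refine ⟨N + M, s ^ M * q + s ^ N * q', s ^ M * r + s ^ N * r',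
      add_mem (mul_mem (pow_mem hs _) hr) (mul_mem (pow_mem hs _) hr'), ?_⟩
    linear_combination s ^ M * e + s ^ N * e'
  | mul x y _ _ hx hy =>
    obtain ⟨N, q, r, hr, e⟩ := hx
    obtain ⟨M, q', r', hr', e'⟩ := hy
    refine ⟨N + M, q * (q' * (s * X K + T) + r') + r * q', r * r', mul_mem hr hr', ?_⟩
    linear_combination s ^ M * y * e + (q * (s * X K + T) + r) * e'

/-- If `P` has a relation of degree one in `v`, and this relation lies in the saturated ideal `J`,
then the elements of `P` in the variables `insert v W` are in `J` as soon as those in the variables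
`W` are. -/
lemma mem_of_eliminate {P J : Ideal (MvPolynomial ι k)} {W : Set ι} {v : ι}
    {s T : MvPolynomial ι k} (hs : s ∈ supported k W) (hT : T ∈ supported k W)
    (hP : s * X v + T ∈ P) (hJ : s * X v + T ∈ J) (hsat : ∀ y, s * y ∈ J → y ∈ J)
    (hW : ∀ g ∈ P, g ∈ supported k W → g ∈ J) {g : MvPolynomial ι k} (hg : g ∈ P)
    (hgW : g ∈ supported k (insert v W)) : g ∈ J := by
  obtain ⟨N, q, r, hr, e⟩ := exists_eliminate hs hT hgW
  have hrP : r ∈ P := by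
    have : r = s ^ N * g - q * (s * X v + T) := by rw [e]; ring
    rw [this]
    exact P.sub_mem (P.mul_mem_left _ hg) (P.mul_mem_left _ hP)
  have hsat' : ∀ (N : ℕ) y, s ^ N * y ∈ J → y ∈ J := by
    intro N
    induction N with
    | zero => intro y hy; simpa using hy
    | succ N ih =>
      intro y hy
      exact ih y (hsat _ (by rwa [← mul_assoc, ← pow_succ']))
  refine hsat' N g ?_
  rw [e]
  exact J.add_mem (J.mul_mem_left _ hJ) (hW r hrP hr)

variable [LinearOrder ι] [CharZero k]

/-- Enlarging the set of variables by a new largest variable `v`: either no new elements of `P`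
arise modulo `J`, or there is a polynomial in `P` which depends on `v` and whose smallest variable
`a` cannot be eliminated in favour of variables strictly between `a` and `v`. For the latter, `a` is
taken as large as possible. -/
lemma forall_mem_or_exists_not_eliminable {P J : Ideal (MvPolynomial ι k)} (hP : P.IsPrime)
    {I : Finset ι} {v : ι} (hv : v ∈ I) (hmax : ∀ y ∈ I, y ≤ v)
    (hJ : ∀ g ∈ P, g ∈ supported k ((I : Set ι) \ {v}) → g ∈ J) :
    (∀ g ∈ P, g ∈ supported k (I : Set ι) → g ∈ J) ∨
      ∃ a, ∃ f ∈ P, a ∈ f.vars ∧ v ∈ f.vars ∧ (∀ y ∈ f.vars, y ∈ I ∧ a ≤ y ∧ y ≤ v) ∧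
        (∀ y ∈ f.vars, pderiv y f ∉ P) ∧
        ∀ s T, s ∉ P → s ∈ supported k {y | y ∈ I ∧ a < y ∧ y < v} →
          T ∈ supported k {y | y ∈ I ∧ a < y ∧ y < v} → s * X a + T ∈ P → a < v → False := by
  classical
  by_cases hex : ∃ f ∈ P, f ∈ supported k (I : Set ι) ∧ pderiv v f ∉ P
  swap
  · push Not at hex
    left
    intro g hg hgI
    have e : insert v ((I : Set ι) \ {v}) = I := by simp [hv]
    refine mem_of_pderiv_mem (x := v) hJ hg (by rwa [e]) fun h h1 h2 _ => ?_
    exact hex h h1 (by rwa [e] at h2)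
  right
  set A := I.filter fun a => ∃ f ∈ P, f ∈ supported k (I : Set ι) ∧ pderiv v f ∉ P ∧
    ∀ y ∈ f.vars, a ≤ y with hA
  have hmemA : ∀ f ∈ P, f ∈ supported k (I : Set ι) → ∀ h : pderiv v f ∉ P,
      f.vars.min' ⟨v, mem_vars_of_pderiv_notMem h⟩ ∈ A := fun f h1 h2 h3 =>
    Finset.mem_filter.2 ⟨mem_supported.1 h2 (Finset.min'_mem _ _), f, h1, h2, h3,
      fun y hy => Finset.min'_le _ _ hy⟩
  have hAne : A.Nonempty := by
    obtain ⟨f, h1, h2, h3⟩ := hex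
    exact ⟨_, hmemA f h1 h2 h3⟩
  set a := A.max' hAne with ha
  obtain ⟨-, f₁, hf₁P, hf₁I, hf₁v, hf₁a⟩ := Finset.mem_filter.1 (A.max'_mem hAne)
  obtain ⟨f, hfP, hfv, hfS, -, hfall⟩ := exists_separable hf₁P hf₁v
  have hfIa : f ∈ supported k {y | y ∈ I ∧ a ≤ y} :=
    hfS _ (mem_supported.2 fun y hy => ⟨mem_supported.1 hf₁I hy, hf₁a y hy⟩)
  have hfI := hfS _ hf₁I
  have hvv := mem_vars_of_pderiv_notMem hfv
  have hav : a ∈ f.vars := by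
    have h1 := Finset.le_max' A _ (hmemA f hfP hfI hfv)
    have h2 : f.vars.min' ⟨v, hvv⟩ ∈ f.vars := Finset.min'_mem _ _
    have h3 : f.vars.min' ⟨v, hvv⟩ = a := le_antisymm h1 (mem_supported.1 hfIa h2).2
    rwa [h3] at h2
  refine ⟨a, f, hfP, hav, hvv, fun y hy => ⟨(mem_supported.1 hfIa hy).1,
    (mem_supported.1 hfIa hy).2, hmax y (mem_supported.1 hfIa hy).1⟩, hfall, ?_⟩
  intro s T hsP hs hT hF hlt
  have hsub : {y | y ∈ I ∧ a < y ∧ y < v} ⊆ {y | y ∈ I ∧ a < y} := fun y hy => ⟨hy.1, hy.2.1⟩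
  obtain ⟨N, q, r, hr, e⟩ := exists_eliminate (K := a) (supported_mono hsub hs)
    (supported_mono hsub hT) (g := f) (supported_mono (fun y hy => by
      rcases hy.2.eq_or_lt with h | h
      · exact Or.inl h.symm
      · exact Or.inr ⟨hy.1, h⟩) hfIa)
  have er : r = s ^ N * f - q * (s * X a + T) := by rw [e]; ring
  have hrP : r ∈ P := by
    rw [er]
    exact P.sub_mem (P.mul_mem_left _ hfP) (P.mul_mem_left _ hF)
  have hvn : v ∉ {y | y ∈ I ∧ a < y ∧ y < v} := fun h => lt_irrefl _ h.2.2
  have hrv : pderiv v r ∉ P := by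
    intro h
    have h0 : pderiv v (s * X a + T) = 0 := by
      rw [map_add, pderiv_mul, pderiv_eq_zero_of_mem_supported hs hvn,
        pderiv_eq_zero_of_mem_supported hT hvn, pderiv_X_of_ne hlt.ne]
      ring
    rw [er, map_sub, pderiv_mul, pderiv_mul, h0,
      pderiv_eq_zero_of_mem_supported (pow_mem hs N) hvn, zero_mul, zero_add, mul_zero,
      add_zero] at h
    have h1 := P.add_mem h (P.mul_mem_left (pderiv v q) hF)
    rw [sub_add_cancel] at h1
    rcases hP.mem_or_mem h1 with h2 | h2
    · exact hsP (hP.mem_of_pow_mem N h2)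
    · exact hfv h2
  have hrI : r ∈ supported k (I : Set ι) := supported_mono (fun y hy => hy.1) hr
  have h1 := Finset.le_max' A _ (hmemA r hrP hrI hrv)
  have h2 : r.vars.min' ⟨v, mem_vars_of_pderiv_notMem hrv⟩ ∈ r.vars := Finset.min'_mem _ _
  exact absurd (mem_supported.1 hr h2).2 (not_lt.2 h1)

end Elimination

/-! ### Iterated brackets of a polynomial with basis elements -/

section Bracket

variable {k : Type*} {L : Type*} {ι : Type*} [Field k] [LieRing L] [LieAlgebra k L]
  (b : Module.Basis ι k L)

/-- The embedding of the Lie algebra in its symmetric algebra, for a bare basis: neither a degree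
nor an order is fixed, so that the same facts apply to the reversed order. -/
noncomputable def symEmb : L →ₗ[k] MvPolynomial ι k := b.constr k (X : ι → MvPolynomial ι k)

/-- The Poisson bracket `{-, M}` with the basis element `M`, as a derivation. -/
noncomputable def bracketX (M : ι) : Derivation k (MvPolynomial ι k) (MvPolynomial ι k) :=
  mkDerivation k fun i => symEmb b ⁅b i, b M⁆

/-- The iterated Poisson bracket `{{f, M₁}, …, Mₙ}`. -/
noncomputable def iterPoisson (t : List ι) (f : MvPolynomial ι k) : MvPolynomial ι k :=
  t.foldl (fun x M => bracketX b M x) f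

/-- The iterated Lie bracket `[[e, M₁], …, Mₙ]`. -/
noncomputable def iterLie (t : List ι) (e : L) : L := t.foldl (fun x M => ⁅x, b M⁆) e

lemma symEmb_basis (i : ι) : symEmb b (b i) = X i := b.constr_basis k _ i

lemma symEmb_mem_supported {S : Set ι} {e : L} (h : ∀ y ∈ (b.repr e).support, y ∈ S) :
    symEmb b e ∈ supported k S := by
  rw [symEmb, Module.Basis.constr_apply, Finsupp.sum]
  exact sum_mem fun y hy => Subalgebra.smul_mem _ (X_mem_supported.2 (h y hy)) _

lemma bracketX_symEmb (M : ι) (e : L) : bracketX b M (symEmb b e) = symEmb b ⁅e, b M⁆ := by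
  have h : (bracketX b M).toLinearMap ∘ₗ symEmb b =
      symEmb b ∘ₗ (-(LieAlgebra.ad k L (b M) : L →ₗ[k] L)) := by
    refine b.ext fun i => ?_
    simp only [LinearMap.comp_apply, Derivation.coeFn_coe,
      symEmb_basis, LinearMap.neg_apply, LieAlgebra.ad_apply, lie_skew, bracketX, mkDerivation_X]
  have := LinearMap.congr_fun h e
  simpa only [LinearMap.comp_apply, Derivation.coeFn_coe,
    LinearMap.neg_apply, LieAlgebra.ad_apply, lie_skew] using this

lemma bracketX_eq_sum (M : ι) (f : MvPolynomial ι k) :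
    bracketX b M f = ∑ i ∈ f.vars, pderiv i f * symEmb b ⁅b i, b M⁆ := by
  classical
  have h : bracketX b M f = (∑ i ∈ f.vars, symEmb b ⁅b i, b M⁆ • pderiv i :
      Derivation k (MvPolynomial ι k) (MvPolynomial ι k)) f := by
    refine derivation_eq_of_forall_mem_vars fun j hj => ?_
    rw [bracketX, mkDerivation_X, ← Derivation.coeFnAddMonoidHom_apply, map_sum,
      Finset.sum_apply, Finset.sum_eq_single j]
    · simp
    · intro i _ hij
      simp [pderiv_X_of_ne hij.symm]
    · exact fun h => absurd hj h
  rw [h, ← Derivation.coeFnAddMonoidHom_apply, map_sum, Finset.sum_apply]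
  exact Finset.sum_congr rfl fun i _ => by simp [mul_comm]

variable {b} {deg : ι → ℤ}
  (hgr : ∀ i j, ∀ y ∈ (b.repr ⁅b i, b j⁆).support, deg y = deg i + deg j)

include hgr in
lemma deg_of_mem_support_lie {e : L} {n : ℤ} (he : ∀ y ∈ (b.repr e).support, deg y = n) (M : ι) :
    ∀ y ∈ (b.repr ⁅e, b M⁆).support, deg y = n + deg M := by
  have h : ⁅e, b M⁆ ∈ (Finsupp.supported k k {y | deg y = n + deg M}).comap
      (b.repr : L →ₗ[k] ι →₀ k) := by
    have e1 : ⁅e, b M⁆ = ∑ i ∈ (b.repr e).support, b.repr e i • ⁅b i, b M⁆ := by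
      conv_lhs => rw [← b.linearCombination_repr e, Finsupp.linearCombination_apply, Finsupp.sum]
      rw [sum_lie]
      exact Finset.sum_congr rfl fun i _ => smul_lie _ _ _
    rw [e1]
    refine sum_mem fun i hi => Submodule.smul_mem _ _ ?_
    intro y hy
    rw [← he i hi]
    exact hgr i M y hy
  exact fun y hy => h hy

include hgr in
lemma deg_of_mem_support_iterLie {e : L} {n : ℤ} (he : ∀ y ∈ (b.repr e).support, deg y = n)
    (t : List ι) : ∀ y ∈ (b.repr (iterLie b t e)).support, deg y = n + (t.map deg).sum := by
  induction t generalizing e n with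
  | nil => simpa [iterLie] using he
  | cons M t ih =>
    have := ih (deg_of_mem_support_lie hgr he M)
    simpa [iterLie, add_assoc] using this

lemma deg_of_mem_support_basis (i : ι) : ∀ y ∈ (b.repr (b i)).support, deg y = deg i := by
  intro y hy
  rw [b.repr_self] at hy
  rw [Finset.mem_singleton.1 (Finsupp.support_single_subset hy)]

variable [LinearOrder ι] (hlt : ∀ i j, deg i < deg j → i < j)

include hgr hlt in
lemma bracketX_mem_supported {a M : ι} (hM : 0 < deg M) {δ : ℤ} {f : MvPolynomial ι k}
    (hf : f ∈ supported k {y | a ≤ y ∧ deg y < δ}) :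
    bracketX b M f ∈ supported k {y | a ≤ y ∧ deg y < δ + deg M} := by
  have hsub : {y | a ≤ y ∧ deg y < δ} ⊆ {y | a ≤ y ∧ deg y < δ + deg M} :=
    fun y hy => ⟨hy.1, hy.2.trans (by omega)⟩
  refine derivation_mem_supported _ hsub (fun i hi => ?_) hf
  rw [bracketX, mkDerivation_X]
  refine symEmb_mem_supported b fun y hy => ?_
  have h := hgr i M y hy
  exact ⟨hi.1.trans (hlt i y (by omega)).le, by have := hi.2; omega⟩

include hgr hlt in
/-- An iterated bracket of `f` is the sum of the terms `∂f/∂i · [[i, M₁], …, Mₙ]` and a remainder,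
whose terms distribute the `Mⱼ` over several factors and thus only involve variables of lower
degree. -/
lemma iterPoisson_sub_mem_supported {f : MvPolynomial ι k} {a β : ι}
    (hf : ∀ y ∈ f.vars, a ≤ y ∧ y ≤ β) {t : List ι} (ht : t ≠ []) (hpos : ∀ M ∈ t, 0 < deg M) :
    iterPoisson b t f - ∑ i ∈ f.vars, pderiv i f * symEmb b (iterLie b t (b i)) ∈
      supported k {y | a ≤ y ∧ deg y < deg β + (t.map deg).sum} := by
  have hdeg : ∀ y ∈ f.vars, deg y ≤ deg β := fun y hy =>
    not_lt.1 fun h => absurd (hlt _ _ h) (not_lt.2 (hf y hy).2)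
  induction t using List.reverseRecOn with
  | nil => exact absurd rfl ht
  | append_singleton t N ih =>
    have hN : 0 < deg N := hpos N (by simp)
    rcases eq_or_ne t [] with rfl | hne
    · have : iterPoisson b ([] ++ [N]) f = bracketX b N f := rfl
      rw [this, bracketX_eq_sum]
      simp [iterLie]
    have hpos' : ∀ M ∈ t, 0 < deg M := fun M hM => hpos M (by simp [hM])
    have ih := ih hne hpos'
    have hsum : 0 < (t.map deg).sum :=
      List.sum_pos _ (by simpa using hpos') (by simpa using hne)
    set R := iterPoisson b t f - ∑ i ∈ f.vars, pderiv i f * symEmb b (iterLie b t (b i)) with hR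
    have e1 : iterPoisson b (t ++ [N]) f = bracketX b N (iterPoisson b t f) := by
      simp [iterPoisson]
    have e2 : iterPoisson b t f =
        ∑ i ∈ f.vars, pderiv i f * symEmb b (iterLie b t (b i)) + R := by rw [hR]; ring
    have e3 : ∀ i, iterLie b (t ++ [N]) (b i) = ⁅iterLie b t (b i), b N⁆ := by
      simp [iterLie]
    have e4 : iterPoisson b (t ++ [N]) f -
        ∑ i ∈ f.vars, pderiv i f * symEmb b (iterLie b (t ++ [N]) (b i)) =
        ∑ i ∈ f.vars, bracketX b N (pderiv i f) * symEmb b (iterLie b t (b i)) +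
          bracketX b N R := by
      rw [e1, e2, map_add, map_sum]
      simp only [Derivation.leibniz, bracketX_symEmb, e3, smul_eq_mul, Finset.sum_add_distrib,
        mul_comm (symEmb b _)]
      ring
    have hf' : f ∈ supported k {y | a ≤ y ∧ deg y < deg β + 1} :=
      mem_supported.2 fun y hy => ⟨(hf y hy).1, by have := hdeg y hy; omega⟩
    rw [e4, List.map_append, List.sum_append, ← add_assoc]
    simp only [List.map_cons, List.map_nil, List.sum_cons, List.sum_nil, add_zero]
    refine add_mem (sum_mem fun i hi => mul_mem ?_ ?_) (bracketX_mem_supported hgr hlt hN ih)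
    · have hsub : {y | a ≤ y ∧ deg y < deg β + 1 + deg N} ⊆
          {y | a ≤ y ∧ deg y < deg β + (t.map deg).sum + deg N} :=
        fun y hy => ⟨hy.1, hy.2.trans_le (by omega)⟩
      exact supported_mono hsub
        (bracketX_mem_supported hgr hlt hN (pderiv_mem_supported i hf'))
    · refine symEmb_mem_supported b fun y hy => ?_
      have h := deg_of_mem_support_iterLie hgr (deg_of_mem_support_basis (deg := deg) i) t y hy
      have h2 := hdeg i hi
      exact ⟨(hf i hi).1.trans (hlt i y (by omega)).le, by omega⟩

include hgr hlt in
/-- If `K` is the largest basis element in `[[β, M₁], …, Mₙ]`, where `β` is the largest variable of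
`f`, and it dominates the brackets of the smaller basis elements, then a multiple of the iterated
bracket of `f` is a relation of degree one in `K` with leading coefficient the separant. -/
lemma exists_leading_form {f : MvPolynomial ι k} {a β K : ι} (hf : ∀ y ∈ f.vars, a ≤ y ∧ y ≤ β)
    (hβ : β ∈ f.vars) {t : List ι} (ht : t ≠ []) (hpos : ∀ M ∈ t, 0 < deg M)
    (hK : K ∈ (b.repr (iterLie b t (b β))).support)
    (hmax : ∀ y ∈ (b.repr (iterLie b t (b β))).support, y ≤ K)
    (hlow : ∀ N < β, ∀ y ∈ (b.repr (iterLie b t (b N))).support, y < K) :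
    β < K ∧ ∃ (c : k) (T : MvPolynomial ι k), T ∈ supported k {y | a ≤ y ∧ y < K} ∧
      C c * iterPoisson b t f = pderiv β f * X K + T := by
  classical
  have hR := iterPoisson_sub_mem_supported hgr hlt hf ht hpos
  have hsum : 0 < (t.map deg).sum :=
    List.sum_pos _ (by simpa using hpos) (by simpa using ht)
  have hdegi : ∀ i, ∀ y ∈ (b.repr (iterLie b t (b i))).support, deg y = deg i + (t.map deg).sum :=
    fun i => deg_of_mem_support_iterLie hgr (deg_of_mem_support_basis i) t
  have hKdeg := hdegi β K hK
  have hβK : β < K := hlt _ _ (by omega)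
  set R := iterPoisson b t f - ∑ i ∈ f.vars, pderiv i f * symEmb b (iterLie b t (b i)) with hRdef
  set e := iterLie b t (b β) with he
  set c := b.repr e K with hc
  have hc0 : c ≠ 0 := Finsupp.mem_support_iff.1 hK
  have hfS : f ∈ supported k {y | a ≤ y ∧ y < K} :=
    mem_supported.2 fun y hy => ⟨(hf y hy).1, (hf y hy).2.trans_lt hβK⟩
  have hR' : R ∈ supported k {y | a ≤ y ∧ y < K} :=
    supported_mono (fun y (hy : a ≤ y ∧ deg y < deg β + (t.map deg).sum) =>
      (⟨hy.1, hlt _ _ (hKdeg ▸ hy.2)⟩ : a ≤ y ∧ y < K)) hR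
  have ha : ∀ i ∈ f.vars, ∀ y ∈ (b.repr (iterLie b t (b i))).support, a ≤ y := fun i hi y hy =>
    (hf i hi).1.trans (hlt i y (by have := hdegi i y hy; omega)).le
  have hlead : symEmb b (e - c • b K) ∈ supported k {y | a ≤ y ∧ y < K} := by
    refine symEmb_mem_supported b fun y hy => ?_
    rw [Finsupp.mem_support_iff, map_sub, map_smul, b.repr_self, Finsupp.sub_apply,
      Finsupp.smul_apply, Finsupp.single_apply] at hy
    have hyK : y ≠ K := by
      rintro rfl
      simp [hc] at hy
    rw [if_neg hyK.symm, smul_zero, sub_zero] at hy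
    have hys := Finsupp.mem_support_iff.2 hy
    exact ⟨ha β hβ y hys, lt_of_le_of_ne (hmax y hys) hyK⟩
  have hrest : ∑ i ∈ f.vars.erase β, pderiv i f * symEmb b (iterLie b t (b i)) ∈
      supported k {y | a ≤ y ∧ y < K} := by
    refine sum_mem fun i hi => mul_mem (pderiv_mem_supported i hfS) ?_
    obtain ⟨h1, h2⟩ := Finset.mem_erase.1 hi
    exact symEmb_mem_supported b fun y hy =>
      ⟨ha i h2 y hy, hlow i (lt_of_le_of_ne (hf i h2).2 h1) y hy⟩
  refine ⟨hβK, c⁻¹, C c⁻¹ * (pderiv β f * symEmb b (e - c • b K) +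
    ∑ i ∈ f.vars.erase β, pderiv i f * symEmb b (iterLie b t (b i)) + R),
    mul_mem (Subalgebra.algebraMap_mem _ c⁻¹) (add_mem (add_mem
      (mul_mem (pderiv_mem_supported β hfS) hlead) hrest) hR'), ?_⟩
  have e1 : iterPoisson b t f = pderiv β f * symEmb b e +
      ∑ i ∈ f.vars.erase β, pderiv i f * symEmb b (iterLie b t (b i)) + R := by
    rw [he, Finset.add_sum_erase _ (fun i => pderiv i f * symEmb b (iterLie b t (b i))) hβ, hRdef]
    ring
  have e2 : symEmb b e = C c * X K + symEmb b (e - c • b K) := by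
    rw [map_sub, map_smul, symEmb_basis, smul_eq_C_mul]; ring
  have e3 : (C c⁻¹ : MvPolynomial ι k) * C c = 1 := by
    rw [← C_mul, inv_mul_cancel₀ hc0, C_1]
  rw [e1, e2]
  linear_combination (pderiv β f * X K) * e3

end Bracket

/-! ### Homogeneous bases -/

namespace HomogeneousBasis

section Graded

variable {k : Type*} {L : Type*} {ι : Type*} [Field k] [LieRing L] [LieAlgebra k L]
  [LinearOrder ι] {𝒢 : ℤ → Submodule k L} [GradedLieAlgebra 𝒢] (B : HomogeneousBasis 𝒢 ι)

lemma repr_decompose (m : ℤ) (e : L) (y : ι) :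
    B.basis.repr (DirectSum.decompose 𝒢 e m : L) y =
      if B.deg y = m then B.basis.repr e y else 0 := by
  induction B.basis.mem_span e using Submodule.span_induction with
  | zero => simp
  | add e f _ _ he hf =>
    rw [DirectSum.decompose_add, DirectSum.add_apply, Submodule.coe_add, map_add, map_add,
      Finsupp.add_apply, Finsupp.add_apply, he, hf]
    split_ifs <;> simp
  | smul c e _ he =>
    rw [DirectSum.decompose_smul, DirectSum.smul_apply, Submodule.coe_smul, map_smul, map_smul,
      Finsupp.smul_apply, Finsupp.smul_apply, he]
    split_ifs <;> simp
  | mem e he =>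
    obtain ⟨i, rfl⟩ := he
    by_cases him : B.deg i = m
    · subst him
      rw [DirectSum.decompose_of_mem_same 𝒢 (B.basis_mem i), B.basis.repr_self,
        Finsupp.single_apply]
      split_ifs with h1 h2 h2
      · rfl
      · subst h1; exact absurd rfl h2
      · rfl
      · rfl
    · rw [DirectSum.decompose_of_mem_ne 𝒢 (B.basis_mem i) him, map_zero, B.basis.repr_self,
        Finsupp.single_apply]
      split_ifs with h1 h2
      · subst h2; exact absurd h1 him
      · rfl
      · rfl

lemma deg_of_mem_support {e : L} {n : ℤ} (he : e ∈ 𝒢 n) :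
    ∀ y ∈ (B.basis.repr e).support, B.deg y = n := by
  intro y hy
  by_contra hne
  have h := B.repr_decompose n e y
  rw [DirectSum.decompose_of_mem_same 𝒢 he, if_neg hne] at h
  exact Finsupp.mem_support_iff.1 hy h

lemma deg_of_mem_support_bracket (i j : ι) :
    ∀ y ∈ (B.basis.repr ⁅B.basis i, B.basis j⁆).support, B.deg y = B.deg i + B.deg j :=
  B.deg_of_mem_support (SetLike.GradedBracket.bracket_mem (B.basis_mem i) (B.basis_mem j))

end Graded

variable {k : Type*} {L : Type*} {ι : Type*} [Field k] [LieRing L] [LieAlgebra k L]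
  [LinearOrder ι] {𝒢 : ℤ → Submodule k L} (B : HomogeneousBasis 𝒢 ι)

lemma finite_setOf_deg_eq [∀ n, Module.Finite k (𝒢 n)] (n : ℤ) : {i | B.deg i = n}.Finite := by
  have hli : LinearIndependent k fun i : {i // B.deg i = n} =>
      (⟨B.basis i, by have := B.basis_mem i; rwa [i.2] at this⟩ : 𝒢 n) := by
    refine LinearIndependent.of_comp (𝒢 n).subtype ?_
    exact B.basis.linearIndependent.comp Subtype.val Subtype.val_injective
  exact Set.finite_coe_iff.1 hli.finite

include B in
lemma exists_interval [∀ n, Module.Finite k (𝒢 n)] (S : Finset ι) :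
    ∃ I : Finset ι, S ⊆ I ∧ ∀ x ∈ I, ∀ y ∈ I, ∀ z, x ≤ z → z ≤ y → z ∈ I := by
  rcases S.eq_empty_or_nonempty with rfl | hS
  · exact ⟨∅, by simp, by simp⟩
  set a := S.min' hS
  set b := S.max' hS
  have hdeg : ∀ x y, x ≤ y → B.deg x ≤ B.deg y := fun x y h =>
    not_lt.1 fun h' => absurd (B.lt_of_deg_lt _ _ h') (not_lt.2 h)
  have hfin : (Set.Icc a b).Finite := by
    refine ((Set.finite_Icc (B.deg a) (B.deg b)).biUnion
      fun n _ => B.finite_setOf_deg_eq n).subset fun z hz => ?_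
    exact Set.mem_biUnion (x := B.deg z) ⟨hdeg _ _ hz.1, hdeg _ _ hz.2⟩ rfl
  refine ⟨hfin.toFinset, fun z hz => ?_, fun x hx y hy z h1 h2 => ?_⟩
  · exact hfin.mem_toFinset.2 ⟨S.min'_le _ hz, S.le_max' _ hz⟩
  · exact hfin.mem_toFinset.2
      ⟨(hfin.mem_toFinset.1 hx).1.trans h1, h2.trans (hfin.mem_toFinset.1 hy).2⟩

/-! ### Poisson ideals -/

lemma poisson_X (f : MvPolynomial ι k) (M : ι) :
    B.poisson f (X M) = bracketX B.basis M f := by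
  simp only [poisson, bracketX, mkDerivation_X]
  rfl

lemma IsPoissonIdeal.iterPoisson_mem {B : HomogeneousBasis 𝒢 ι} {J : Ideal (MvPolynomial ι k)}
    (hJ : B.IsPoissonIdeal J) (t : List ι) {f : MvPolynomial ι k} (hf : f ∈ J) :
    iterPoisson B.basis t f ∈ J := by
  induction t generalizing f with
  | nil => exact hf
  | cons M t ih =>
    refine ih ?_
    change bracketX B.basis M f ∈ J
    rw [← B.poisson_X]
    exact hJ f hf _

lemma isPoissonIdeal_poissonSpan (S : Set (MvPolynomial ι k)) :
    B.IsPoissonIdeal (B.poissonSpan S) := by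
  intro f hf g
  rw [poissonSpan, Submodule.mem_sInf] at *
  exact fun I hI => hI.1 f (hf I hI) g

lemma subset_poissonSpan (S : Set (MvPolynomial ι k)) : S ⊆ B.poissonSpan S := by
  intro f hf
  rw [SetLike.mem_coe, poissonSpan, Submodule.mem_sInf]
  exact fun I hI => hI.2 hf

lemma IsPoissonIdeal.divInfinity {B : HomogeneousBasis 𝒢 ι} {I : Ideal (MvPolynomial ι k)}
    (hI : B.IsPoissonIdeal I) (s : MvPolynomial ι k) :
    B.IsPoissonIdeal (divInfinity I s) := by
  rintro f ⟨n, hn⟩ g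
  refine ⟨n + 1, ?_⟩
  set D := mkDerivation k fun i => mkDerivation k (fun j => B.toSym ⁅B.basis i, B.basis j⁆) g
  have h1 : D (f * s ^ n) ∈ I := hI _ hn g
  have h2 : s * D (s ^ n) = n * s ^ n * D s := by
    rw [D.leibniz_pow]
    rcases n with _ | n
    · simp
    · simp only [Nat.add_sub_cancel, smul_eq_mul, nsmul_eq_mul]
      ring
  have e : B.poisson f g * s ^ (n + 1) = s * D (f * s ^ n) - n * D s * (f * s ^ n) := by
    change D f * s ^ (n + 1) = _
    rw [D.leibniz, smul_eq_mul, smul_eq_mul]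
    linear_combination -f * h2
  rw [e]
  exact I.sub_mem (I.mul_mem_left _ h1) (I.mul_mem_left _ hn)

/-! ### Relations for the elements of `𝓛₊` and `𝓛₋` -/

section Relations

variable [GradedLieAlgebra 𝒢]

/-- An element `K` of `𝓛₊(ℓ₊(f))` is the leading variable of an element `s₊ K + T` of every Poisson
ideal that contains `f`, and `T` only involves variables between the lower leader of `f` and `K`. -/
lemma exists_upper_relation {J : Ideal (MvPolynomial ι k)} (hJ : B.IsPoissonIdeal J)
    {f : MvPolynomial ι k} (hfJ : f ∈ J) {a b K : ι} (hf : ∀ y ∈ f.vars, a ≤ y ∧ y ≤ b)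
    (hb : b ∈ f.vars) (hK : K ∈ B.upperSet b) :
    b < K ∧ ∃ T ∈ supported k {y | a ≤ y ∧ y < K}, pderiv b f * X K + T ∈ J := by
  obtain ⟨t, ht, hpos, hlead, hlow⟩ := hK
  obtain ⟨hbK, c, T, hT, e⟩ := exists_leading_form B.deg_of_mem_support_bracket B.lt_of_deg_lt
    hf hb ht hpos (Finset.mem_of_max hlead) (fun y hy => Finset.le_max_of_eq hy hlead)
    (fun N hN y hy => WithBot.coe_lt_coe.1 ((Finset.le_max hy).trans_lt (hlow N hN fun h0 => by
      change iterLie B.basis t (B.basis N) = 0 at h0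
      simp [h0] at hy)))
  exact ⟨hbK, T, hT, e ▸ J.mul_mem_left _ (hJ.iterPoisson_mem t hfJ)⟩

/-- The mirror image of `exists_upper_relation`, for the reversed order and the opposite degrees. -/
lemma exists_lower_relation {J : Ideal (MvPolynomial ι k)} (hJ : B.IsPoissonIdeal J)
    {f : MvPolynomial ι k} (hfJ : f ∈ J) {a b K : ι} (hf : ∀ y ∈ f.vars, a ≤ y ∧ y ≤ b)
    (ha : a ∈ f.vars) (hK : K ∈ B.lowerSet a) :
    K < a ∧ ∃ T ∈ supported k {y | K < y ∧ y ≤ b}, pderiv a f * X K + T ∈ J := by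
  obtain ⟨t, ht, hneg, hlead, hlow⟩ := hK
  have hmem : K ∈ (B.basis.repr (iterLie B.basis t (B.basis a))).support :=
    Finset.mem_of_min hlead
  have hmin : ∀ y ∈ (B.basis.repr (iterLie B.basis t (B.basis a))).support, K ≤ y :=
    fun y hy => Finset.min_le_of_eq hy hlead
  have hlow' : ∀ N > a, ∀ y ∈ (B.basis.repr (iterLie B.basis t (B.basis N))).support, K < y :=
    fun N hN y hy => WithTop.coe_lt_coe.1 ((hlow N hN fun h0 => by
      change iterLie B.basis t (B.basis N) = 0 at h0
      simp [h0] at hy).trans_le (Finset.min_le hy))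
  obtain ⟨haK, c, T, hT, e⟩ := exists_leading_form (ι := ιᵒᵈ) (b := B.basis)
    (deg := fun i => -B.deg i)
    (fun i j y hy => by have := B.deg_of_mem_support_bracket i j y hy; omega)
    (fun i j h => B.lt_of_deg_lt j i (by omega))
    (f := f) (a := b) (β := a) (K := K) (fun y hy => ⟨(hf y hy).2, (hf y hy).1⟩) ha ht
    (fun M hM => by have := hneg M hM; omega) hmem hmin hlow'
  refine ⟨haK, T, ?_, e ▸ J.mul_mem_left _ (hJ.iterPoisson_mem t hfJ)⟩
  exact supported_mono (t := {y | K < y ∧ y ≤ b}) (fun y hy => ⟨hy.2, hy.1⟩) hT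

end Relations

/-- The pair `(a, b)` consists of the smallest and the largest variable of a polynomial in `P`, all
of whose derivatives, in the variables that it involves, are outside `P`. -/
def IsLeaderPair (P : Ideal (MvPolynomial ι k)) (p : ι × ι) : Prop :=
  ∃ f ∈ P, p.1 ∈ f.vars ∧ p.2 ∈ f.vars ∧ ∀ y ∈ f.vars, (p.1 ≤ y ∧ y ≤ p.2) ∧ pderiv y f ∉ P

lemma IsDicksonian.exists_finset {B : HomogeneousBasis 𝒢 ι} (hB : B.IsDicksonian)
    (P : Ideal (MvPolynomial ι k)) :
    ∃ s : Finset (ι × ι), (∀ p ∈ s, IsLeaderPair P p) ∧ ∀ q, IsLeaderPair P q →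
      ∃ p ∈ s, p = q ∨ q.1 ∈ B.lowerSet p.1 ∨ q.2 ∈ B.upperSet p.2 := by
  by_contra! hcon
  obtain ⟨σ, hσ, hr⟩ := exists_seq_of_forall_finset_exists (IsLeaderPair P)
    (fun p q => p ≠ q ∧ q.1 ∉ B.lowerSet p.1 ∧ q.2 ∉ B.upperSet p.2) hcon
  refine hB ⟨σ, ?_, fun n => ?_, fun i j h => (hr i j h).2.1, fun i j h => (hr i j h).2.2⟩
  · intro i j hij
    by_contra hne
    rcases lt_or_gt_of_ne hne with h | h
    · exact (hr i j h).1 hij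
    · exact (hr j i h).1 hij.symm
  · obtain ⟨f, -, h1, -, h2⟩ := hσ n
    exact (h2 _ h1).1.2

end HomogeneousBasis

/-- Nested lists are reduced: the elements of `𝓛₊(ℓ₊(f))` and `𝓛₋(ℓ₋(f))` lie outside the interval
between the leaders of `f`. -/
lemma IsCompleteList.isReducedSeq {k : Type*} {L : Type*} {ι : Type*} [Field k]
    [LieRing L] [LieAlgebra k L] {𝒢 : ℤ → Submodule k L} [GradedLieAlgebra 𝒢] [LinearOrder ι]
    (B : HomogeneousBasis 𝒢 ι) {P : Ideal (MvPolynomial ι k)} {I : Set ι}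
    {Λ : List (MvPolynomial ι k)} (hΛ : IsCompleteList P I Λ) : B.IsReducedSeq Λ := by
  have htop : B.IsPoissonIdeal ⊤ := fun _ _ _ => trivial
  refine ⟨hΛ.nonempty, hΛ.nested.imp fun {f g} h hf => ⟨⟨fun M hM hU => ?_, fun M hM hU => ?_⟩,
    (h hf).2⟩⟩
  · exact absurd (B.exists_upper_relation htop (f := f) (a := polyLowerLeader f hf) trivial
      (fun y hy => ⟨Finset.min'_le _ _ hy, Finset.le_max' _ _ hy⟩) (Finset.max'_mem _ hf) hU).1
      (not_lt.2 ((h hf).1 M hM).2)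
  · exact absurd (B.exists_lower_relation htop (f := f) (b := polyUpperLeader f hf) trivial
      (fun y hy => ⟨Finset.min'_le _ _ hy, Finset.le_max' _ _ hy⟩) (Finset.min'_mem _ hf) hU).1
      (not_lt.2 ((h hf).1 M hM).1)

open HomogeneousBasis in
/-- An ideal which contains the elements of `P` in the variables of a finite interval `I` contains
all of `P`, if it is Poisson and saturated, and if `I` contains enough leader pairs. -/
lemma le_of_forall_interval {k : Type*} {L : Type*} {ι : Type*} [Field k] [CharZero k]
    [LieRing L] [LieAlgebra k L] {𝒢 : ℤ → Submodule k L} [GradedLieAlgebra 𝒢]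
    [∀ n, Module.Finite k (𝒢 n)] [LinearOrder ι] (B : HomogeneousBasis 𝒢 ι)
    {P J : Ideal (MvPolynomial ι k)} (hP : P.IsPrime) (hPP : B.IsPoissonIdeal P)
    (hJP : B.IsPoissonIdeal J) {s : Finset (ι × ι)} {I : Finset ι} (F : ι × ι → MvPolynomial ι k)
    (hF : ∀ p ∈ s, F p ∈ P ∧ p.1 ∈ (F p).vars ∧ p.2 ∈ (F p).vars ∧
      ∀ y ∈ (F p).vars, (p.1 ≤ y ∧ y ≤ p.2) ∧ pderiv y (F p) ∉ P)
    (hs : ∀ q, IsLeaderPair P q →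
      ∃ p ∈ s, p = q ∨ q.1 ∈ B.lowerSet p.1 ∨ q.2 ∈ B.upperSet p.2)
    (hsI : ∀ p ∈ s, p.1 ∈ I ∧ p.2 ∈ I)
    (hI : ∀ x ∈ I, ∀ y ∈ I, ∀ z, x ≤ z → z ≤ y → z ∈ I)
    (hJI : ∀ g ∈ P, g ∈ supported k (I : Set ι) → g ∈ J)
    (hsat₁ : ∀ p ∈ s, ∀ y, pderiv p.1 (F p) * y ∈ J → y ∈ J)
    (hsat₂ : ∀ p ∈ s, ∀ y, pderiv p.2 (F p) * y ∈ J → y ∈ J) : P ≤ J := by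
  classical
  have hFJ : ∀ p ∈ s, F p ∈ J := fun p hp => hJI _ (hF p hp).1 <| mem_supported.2 fun y hy =>
    hI _ (hsI p hp).1 _ (hsI p hp).2 y ((hF p hp).2.2.2 y hy).1.1 ((hF p hp).2.2.2 y hy).1.2
  have hPJ : B.IsPoissonIdeal (P ⊓ J) := fun f hf g => ⟨hPP f hf.1 g, hJP f hf.2 g⟩
  -- The elements of `P` in the variables of a larger interval, by induction on its size.
  have main : ∀ (n : ℕ) (I' : Finset ι), I'.card = n → I ⊆ I' →
      (∀ x ∈ I', ∀ y ∈ I', ∀ z, x ≤ z → z ≤ y → z ∈ I') →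
      ∀ g ∈ P, g ∈ supported k (I' : Set ι) → g ∈ J := by
    intro n
    induction n with
    | zero =>
      intro I' hcard hsub _ g hg hgI
      rw [Finset.card_eq_zero.1 hcard] at hgI
      exact hJI g hg (supported_mono (by simp) hgI)
    | succ n ih =>
      intro I' hcard hsub hconv
      by_cases heq : I' ⊆ I
      · exact fun g hg hgI => hJI g hg (supported_mono (by exact_mod_cast heq) hgI)
      obtain ⟨w, hwI', hwI⟩ := Finset.not_subset.1 heq
      have hne : I'.Nonempty := ⟨w, hwI'⟩
      have hstep : ∀ v ∈ I', v ∉ I → (∀ x ∈ I', ∀ y ∈ I', x ≠ v → y ≠ v → ∀ z, x ≤ z → z ≤ y →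
          z ≠ v) → ∀ g ∈ P, g ∈ supported k ((I' : Set ι) \ {v}) → g ∈ J := by
        intro v hv hvI hconv' g hg hgI
        refine ih (I'.erase v) (by rw [Finset.card_erase_of_mem hv, hcard]; rfl)
          (fun x hx => Finset.mem_erase.2 ⟨by rintro rfl; exact hvI hx, hsub hx⟩) ?_ g hg
          (by rwa [Finset.coe_erase])
        intro x hx y hy z h1 h2
        obtain ⟨hx1, hx2⟩ := Finset.mem_erase.1 hx
        obtain ⟨hy1, hy2⟩ := Finset.mem_erase.1 hy
        exact Finset.mem_erase.2 ⟨hconv' x hx2 y hy2 hx1 hy1 z h1 h2, hconv x hx2 y hy2 z h1 h2⟩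
      have hor : I'.max' hne ∉ I ∨ I'.min' hne ∉ I := by
        by_contra! h
        exact hwI (hI _ h.2 _ h.1 w (I'.min'_le _ hwI') (I'.le_max' _ hwI'))
      rcases hor with hvI | hvI
      · set v := I'.max' hne with hvdef
        have hv : v ∈ I' := I'.max'_mem hne
        have hmax : ∀ y ∈ I', y ≤ v := fun y hy => I'.le_max' y hy
        have hJ' := hstep v hv hvI fun x hx y hy hxv hyv z h1 h2 =>
          (h2.trans_lt (lt_of_le_of_ne (hmax y hy) hyv)).ne
        rcases forall_mem_or_exists_not_eliminable hP hv hmax hJ' with h | h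
        · exact h
        obtain ⟨a, f, hfP, haf, hvf, hfI, hfd, helim⟩ := h
        obtain ⟨p, hp, hpq⟩ := hs (a, v) ⟨f, hfP, haf, hvf, fun y hy => ⟨(hfI y hy).2, hfd y hy⟩⟩
        obtain ⟨hpP, hp1, hp2, hpv⟩ := hF p hp
        have hp1I := hsub (hsI p hp).1
        have hp2I := hsub (hsI p hp).2
        have hlt2 : p.2 < v := lt_of_le_of_ne (hmax _ hp2I) fun h => hvI (h ▸ (hsI p hp).2)
        rcases hpq with rfl | hlow | hup
        · exact absurd (hsI _ hp).2 hvI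
        · obtain ⟨hlt, T, hT, hTP⟩ := B.exists_lower_relation hPP hpP (fun y hy => (hpv y hy).1)
            hp1 hlow
          refine (helim (pderiv p.1 (F p)) T (hpv _ hp1).2 (pderiv_mem_supported _
            (mem_supported.2 fun y hy => ?_)) (supported_mono (fun y hy => ?_) hT) hTP
            (hlt.trans_le ((hpv _ hp1).1.2.trans hlt2.le))).elim
          · have h := (hpv y hy).1
            exact ⟨hconv _ hp1I _ hp2I y h.1 h.2, hlt.trans_le h.1, h.2.trans_lt hlt2⟩
          · exact ⟨hconv _ (hfI a haf).1 _ hp2I y hy.1.le hy.2, hy.1, hy.2.trans_lt hlt2⟩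
        · obtain ⟨-, T, hT, hTPJ⟩ := B.exists_upper_relation hPJ ⟨hpP, hFJ p hp⟩
            (fun y hy => (hpv y hy).1) hp2 hup
          have hins : insert v ((I' : Set ι) \ {v}) = I' := by simp [hv]
          intro g hg hgI
          refine mem_of_eliminate (pderiv_mem_supported _ (mem_supported.2 fun y hy => ?_))
            (supported_mono (fun y hy => ?_) hT) hTPJ.1 hTPJ.2 (hsat₂ p hp) hJ' hg (by rwa [hins])
          · have h := (hpv y hy).1
            exact ⟨hconv _ hp1I _ hp2I y h.1 h.2, (h.2.trans_lt hlt2).ne⟩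
          · exact ⟨hconv _ hp1I _ hv y hy.1 hy.2.le, hy.2.ne⟩
      · set v := I'.min' hne with hvdef
        have hv : v ∈ I' := I'.min'_mem hne
        have hmin : ∀ y ∈ I', v ≤ y := fun y hy => I'.min'_le y hy
        have hJ' := hstep v hv hvI fun x hx y hy hxv hyv z h1 h2 =>
          ((lt_of_le_of_ne (hmin x hx) hxv.symm).trans_le h1).ne'
        rcases forall_mem_or_exists_not_eliminable (ι := ιᵒᵈ) hP hv hmin hJ' with h | h
        · exact h
        obtain ⟨b, f, hfP, hbf, hvf, hfI, hfd, helim⟩ := h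
        obtain ⟨p, hp, hpq⟩ := hs (v, b) ⟨f, hfP, hvf, hbf,
          fun y hy => ⟨⟨(hfI y hy).2.2, (hfI y hy).2.1⟩, hfd y hy⟩⟩
        obtain ⟨hpP, hp1, hp2, hpv⟩ := hF p hp
        have hp1I := hsub (hsI p hp).1
        have hp2I := hsub (hsI p hp).2
        have hlt1 : v < p.1 := lt_of_le_of_ne (hmin _ hp1I) fun h => hvI (h ▸ (hsI p hp).1)
        rcases hpq with rfl | hlow | hup
        · exact absurd (hsI _ hp).1 hvI
        · obtain ⟨-, T, hT, hTPJ⟩ := B.exists_lower_relation hPJ ⟨hpP, hFJ p hp⟩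
            (fun y hy => (hpv y hy).1) hp1 hlow
          have hins : insert v ((I' : Set ι) \ {v}) = I' := by simp [hv]
          intro g hg hgI
          refine mem_of_eliminate (pderiv_mem_supported _ (mem_supported.2 fun y hy => ?_))
            (supported_mono (fun y hy => ?_) hT) hTPJ.1 hTPJ.2 (hsat₁ p hp) hJ' hg (by rwa [hins])
          · have h := (hpv y hy).1
            exact ⟨hconv _ hp1I _ hp2I y h.1 h.2, (hlt1.trans_le h.1).ne'⟩
          · exact ⟨hconv _ hv _ hp2I y hy.1.le hy.2, hy.1.ne'⟩
        · obtain ⟨hlt, T, hT, hTP⟩ := B.exists_upper_relation hPP hpP (fun y hy => (hpv y hy).1)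
            hp2 hup
          refine (helim (pderiv p.2 (F p)) T (hpv _ hp2).2 (pderiv_mem_supported _
            (mem_supported.2 fun y hy => ?_)) (supported_mono (fun y hy => ?_) hT) hTP
            ((hlt1.trans_le (hpv _ hp1).1.2).trans hlt)).elim
          · have h := (hpv y hy).1
            exact ⟨hconv _ hp1I _ hp2I y h.1 h.2, h.2.trans_lt hlt, hlt1.trans_le h.1⟩
          · exact ⟨hconv _ hp1I _ (hfI b hbf).1 y hy.1 hy.2.le, hy.2, hlt1.trans_le hy.1⟩
  intro g hg
  obtain ⟨I', hI'sub, hI'conv⟩ := B.exists_interval (I ∪ g.vars)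
  exact main _ I' rfl (Finset.union_subset_left hI'sub) hI'conv g hg
    (mem_supported.2 (by exact_mod_cast Finset.union_subset_right hI'sub))

end DicksonLie

open DicksonLie DicksonLie.HomogeneousBasis in
theorem mainTheorem4 {k : Type*} {L : Type*} {ι : Type*} [Field k] [CharZero k]
    [LieRing L] [LieAlgebra k L] (𝒢 : ℤ → Submodule k L) [GradedLieAlgebra 𝒢]
    [∀ n, Module.Finite k (𝒢 n)] [LinearOrder ι]
    (B : DicksonLie.HomogeneousBasis 𝒢 ι) (hB : B.IsDicksonian)
    (P : Ideal (MvPolynomial ι k)) (hP0 : P ≠ ⊥) (hP : P.IsPrime) (hPP : B.IsPoissonIdeal P) :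
    ∃ Λ : List (MvPolynomial ι k), B.IsReducedSeq Λ ∧ (∀ f ∈ Λ, f ∈ P) ∧
      DicksonLie.initSep Λ ∉ P ∧
      P = DicksonLie.divInfinity (B.poissonSpan {f | f ∈ Λ}) (DicksonLie.initSep Λ) := by
  classical
  obtain ⟨s, hsP, hs⟩ := hB.exists_finset P
  have hF' : ∀ p : ι × ι, ∃ f : MvPolynomial ι k, p ∈ s → f ∈ P ∧ p.1 ∈ f.vars ∧ p.2 ∈ f.vars ∧
      ∀ y ∈ f.vars, (p.1 ≤ y ∧ y ≤ p.2) ∧ pderiv y f ∉ P := by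
    intro p
    by_cases hp : p ∈ s
    · obtain ⟨f, hf⟩ := hsP p hp
      exact ⟨f, fun _ => hf⟩
    · exact ⟨0, fun h => absurd h hp⟩
  choose F hF using hF'
  obtain ⟨I, hsI, hI⟩ := B.exists_interval (s.image Prod.fst ∪ s.image Prod.snd)
  have hsI1 : ∀ p ∈ s, p.1 ∈ I ∧ p.2 ∈ I := fun p hp =>
    ⟨hsI (Finset.mem_union_left _ (Finset.mem_image_of_mem _ hp)),
      hsI (Finset.mem_union_right _ (Finset.mem_image_of_mem _ hp))⟩
  have hFI : ∀ p ∈ s, F p ∈ supported k (I : Set ι) := fun p hp => mem_supported.2 fun y hy =>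
    hI _ (hsI1 p hp).1 _ (hsI1 p hp).2 y ((hF p hp).2.2.2 y hy).1.1 ((hF p hp).2.2.2 y hy).1.2
  -- The product of the separants of the chosen polynomials.
  set m : MvPolynomial ι k := ∏ p ∈ s, pderiv p.1 (F p) * pderiv p.2 (F p) with hm
  have hmP : m ∉ P := by
    intro h
    obtain ⟨p, hp, h⟩ := (hP.prod_mem_iff).1 h
    obtain ⟨-, h1, h2, h3⟩ := hF p hp
    exact hP.mul_notMem (h3 _ h1).2 (h3 _ h2).2 h
  have hmv : m ∈ supported k {y | ∃ h ∈ P, h ∈ supported k (I : Set ι) ∧ pderiv y h ∉ P} := by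
    refine prod_mem fun p hp => ?_
    have h : F p ∈ supported k {y | ∃ h ∈ P, h ∈ supported k (I : Set ι) ∧ pderiv y h ∉ P} :=
      mem_supported.2 fun y hy => ⟨F p, (hF p hp).1, hFI p hp, ((hF p hp).2.2.2 y hy).2⟩
    exact mul_mem (pderiv_mem_supported _ h) (pderiv_mem_supported _ h)
  obtain ⟨Λ, hΛ, hsat⟩ := exists_isCompleteList_saturated hP I hmP
    fun y hy => mem_supported.1 hmv hy
  refine ⟨Λ, hΛ.isReducedSeq B, hΛ.mem, hΛ.initSep_notMem, ?_⟩
  set J := divInfinity (B.poissonSpan {f | f ∈ Λ}) (initSep Λ) with hJ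
  have hΛJ : ∀ f ∈ Λ, f ∈ J := fun f hf => ⟨0, by
    rw [pow_zero, mul_one]; exact B.subset_poissonSpan _ hf⟩
  have hJsat : ∀ y, initSep Λ * y ∈ J → y ∈ J := by
    rintro y ⟨n, hn⟩
    exact ⟨n + 1, by rw [pow_succ']; convert hn using 1; ring⟩
  have hmJ := hsat J hΛJ hJsat
  have hsatp : ∀ p ∈ s, ∀ y, pderiv p.1 (F p) * pderiv p.2 (F p) * y ∈ J → y ∈ J := by
    intro p hp y hy
    refine hmJ y ?_
    rw [hm, ← Finset.mul_prod_erase s _ hp, mul_right_comm]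
    exact J.mul_mem_right _ hy
  refine le_antisymm ?_ ?_
  · refine le_of_forall_interval B hP hPP ((B.isPoissonIdeal_poissonSpan _).divInfinity _) F hF hs
      hsI1 hI (hΛ.complete J hΛJ hJsat) (fun p hp y hy => hsatp p hp y ?_)
      (fun p hp y hy => hsatp p hp y ?_)
    · rw [mul_right_comm]; exact J.mul_mem_right _ hy
    · rw [mul_assoc]; exact J.mul_mem_left _ hy
  · rintro f ⟨n, hn⟩
    have h : B.poissonSpan {f | f ∈ Λ} ≤ P := sInf_le ⟨hPP, hΛ.mem⟩
    exact (hP.mem_or_mem (h hn)).resolve_right fun h => hΛ.initSep_notMem (hP.mem_of_pow_mem n h)
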